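/- Let $n\ge 1$ be an integer, let $0<d<n$ be real, and let $\Omega\subset\mathbb R^n$ be an open set whose boundary $\partial\Omega$ is $d$-Ahlfors regular: $\partial\Omega$ is nonempty and there is $A>0$ such that $$\tfrac1A r^d\le \mathcal H^d(B(\xi,r)\cap\partial\Omega)\le A r^d\qquad\text{for all }\xi\in\partial\Omega\text{ and all real } 0<r\le\operatorname{diam}\partial\Omega .$$ Write $\delta(y)=\operatorname{dist}(y,\partial\Omega)$, and let $V$ be a finite-dimensional real normed space (for instance $V=\mathbb R$ or $V=\mathbb R^n$). For $0<c<1$, $1\le\beta\le\infty$, $0<p<\infty$ and $s\in\mathbb R$, let $L^p_{av,c,\beta,s}(\Omega)$ be the space of all $f\in L^\beta_{loc}(\Omega;V)$ (modulo equality almost everywhere) with $$\|f\|_{L^p_{av,c,\beta,s}(\Omega)}=\Bigl(\int_\Omega \mathcal W_{c,\beta}f(y)^p\,\delta(y)^{d-n+p-ps}\,dy\Bigr)^{1/p}<\infty,\qquad \mathcal W_{c,\beta}f(y)=\Bigl(\frac1{|B(y,c\delta(y))|}\int_{B(y,c\delta(y))}|f|^\beta\Bigr)^{1/\beta},$$ where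 $\mathcal W_{c,\infty}f(y)$ is the essential supremum of $|f|$ on $B(y,c\delta(y))$. For quasi-normed spaces $A_0,A_1$ contained in a common vector space, $0<\gamma<1$ and $0<r<\infty$, let $(A_0,A_1)_{\gamma,r}$ be the set of all $a\in A_0+A_1$ with $$\|a\|_{(A_0,A_1)_{\gamma,r}}=\Bigl(\int_0^\infty \bigl(t^{-\gamma}\inf\{\|a_0\|_{A_0}+t\|a_1\|_{A_1}: a_0\in A_0,\ a_1\in A_1,\ a_0+a_1=a\}\bigr)^r\,\frac{dt}{t}\Bigr)^{1/r}<\infty .$$ **Theorem.** Let $p_0,p_1\in(0,\infty)$, $1\le\beta\le\infty$, $s_0,s_1\in\mathbb R$ and $c,\gamma\in(0,1)$, and let $$s_\gamma=(1-\gamma)s_0+\gamma s_1,\qquad \frac1{p_\gamma}=\frac{1-\gamma}{p_0}+\frac{\gamma}{p_1}.$$ Then $$\bigl(L^{p_0}_{av,c,\beta,s_0}(\Omega),\,L^{p_1}_{av,c,\beta,s_1}(\Omega)\bigr)_{\gamma,p_\gamma}=L^{p_\gamma}_{av,c,\beta,s_\gamma}(\Omega),$$ in the sense that the two spaces consist of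 the same functions and their quasi-norms are equivalent. -/

import Mathlib

open MeasureTheory Set
open scoped ENNReal NNReal

noncomputable section

namespace WhitneyAv

/-! ### Ahlfors regular sets -/

/-- A nonempty set `Γ` is `d`-Ahlfors regular if, for some `A > 0`, all `ξ ∈ Γ` and all real
`0 < r ≤ diam Γ`, one has `r ^ d / A ≤ σ (B(ξ, r) ∩ Γ) ≤ A * r ^ d`, where `σ` is the
`d`-dimensional Hausdorff measure. The diameter may be infinite. -/
def AhlforsRegular {X : Type*} [MetricSpace X] [MeasurableSpace X] [BorelSpace X]
    (d : ℝ) (Γ : Set X) : Prop :=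
  Γ.Nonempty ∧ ∃ A : ℝ, 0 < A ∧ ∀ ξ ∈ Γ, ∀ r : ℝ, 0 < r →
    ENNReal.ofReal r ≤ Metric.ediam Γ →
      ENNReal.ofReal (A⁻¹ * r ^ d) ≤ Measure.hausdorffMeasure d (Metric.ball ξ r ∩ Γ) ∧
      Measure.hausdorffMeasure d (Metric.ball ξ r ∩ Γ) ≤ ENNReal.ofReal (A * r ^ d)

/-! ### Real interpolation (K-method) of two quasi-normed spaces

The two spaces are subsets `A₀`, `A₁` of a common additive group `X`, with quasi-norms given by
`N₀`, `N₁ : X → ℝ≥0∞` (only their values on `A₀`, respectively `A₁`, are used). -/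

/-- The sum `A₀ + A₁` inside `X`. -/
def sumSpace {X : Type*} [Add X] (A₀ A₁ : Set X) : Set X :=
  {a | ∃ a₀ ∈ A₀, ∃ a₁ ∈ A₁, a₀ + a₁ = a}

/-- `K(t, a) = inf {‖a₀‖ + t ‖a₁‖ : a₀ ∈ A₀, a₁ ∈ A₁, a₀ + a₁ = a}`. -/
def kFunctional {X : Type*} [Add X] (A₀ A₁ : Set X) (N₀ N₁ : X → ℝ≥0∞) (t : ℝ) (a : X) : ℝ≥0∞ :=
  ⨅ (a₀ ∈ A₀) (a₁ ∈ A₁) (_ : a₀ + a₁ = a), (N₀ a₀ + ENNReal.ofReal t * N₁ a₁)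

/-- `‖a‖ = (∫_0^∞ (t ^ (-γ) K(t, a)) ^ r dt / t) ^ (1 / r)`, for finite `r`. -/
def interpNorm {X : Type*} [Add X] (A₀ A₁ : Set X) (N₀ N₁ : X → ℝ≥0∞) (γ r : ℝ) (a : X) : ℝ≥0∞ :=
  (∫⁻ t in Ioi (0 : ℝ),
    (ENNReal.ofReal (t ^ (-γ)) * kFunctional A₀ A₁ N₀ N₁ t a) ^ r * ENNReal.ofReal t⁻¹) ^ (1 / r)

/-- The real interpolation space `(A₀, A₁)_{γ, r}`. -/
def interpSpace {X : Type*} [Add X] (A₀ A₁ : Set X) (N₀ N₁ : X → ℝ≥0∞) (γ r : ℝ) : Set X :=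
  {a ∈ sumSpace A₀ A₁ | interpNorm A₀ A₁ N₀ N₁ γ r a < ∞}

/-! ### Weighted averaged Lebesgue spaces -/

section

variable {n : ℕ} {V : Type*} [NormedAddCommGroup V]

/-- `δ(y) = dist(y, ∂Ω)`. -/
def bdryDist (Ω : Set (EuclideanSpace ℝ (Fin n))) (y : EuclideanSpace ℝ (Fin n)) : ℝ :=
  Metric.infDist y (frontier Ω)

/-- The Whitney average of `|u|` of exponent `β ∈ [1, ∞]` at `y`: the `L^β` norm of `u` with
respect to normalised Lebesgue measure on the ball `B(y, c δ(y))`. -/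
def whitneyAvg (Ω : Set (EuclideanSpace ℝ (Fin n))) (c : ℝ) (β : ℝ≥0∞)
    (u : EuclideanSpace ℝ (Fin n) → V) (y : EuclideanSpace ℝ (Fin n)) : ℝ≥0∞ :=
  eLpNorm u β ((volume (Metric.ball y (c * bdryDist Ω y)))⁻¹ •
    volume.restrict (Metric.ball y (c * bdryDist Ω y)))

/-- `f ∈ L^β_loc(Ω)`: `f ∈ L^β(K)` for every compact `K ⊆ Ω`. -/
def MemLpLoc (Ω : Set (EuclideanSpace ℝ (Fin n))) (β : ℝ≥0∞)
    (f : EuclideanSpace ℝ (Fin n) → V) : Prop :=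
  ∀ K : Set (EuclideanSpace ℝ (Fin n)), IsCompact K → K ⊆ Ω → MemLp f β (volume.restrict K)

/-- The quasi-norm
`‖f‖ = (∫_Ω (whitneyAvg f y) ^ p * δ(y) ^ (d - n + p - p s) dy) ^ (1 / p)`, for finite `p`.
Functions on `Ω` are taken modulo equality almost everywhere. -/
def avNorm (Ω : Set (EuclideanSpace ℝ (Fin n))) (d p c : ℝ) (β : ℝ≥0∞) (s : ℝ)
    (f : EuclideanSpace ℝ (Fin n) →ₘ[volume.restrict Ω] V) : ℝ≥0∞ :=
  (∫⁻ y in Ω, whitneyAvg Ω c β f y ^ p *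
    ENNReal.ofReal (bdryDist Ω y) ^ (d - (n : ℝ) + p - p * s)) ^ (1 / p)

/-- The weighted averaged Lebesgue space `L^p_{av, c, β, s}(Ω)` of `V`-valued functions. -/
def avSpace (Ω : Set (EuclideanSpace ℝ (Fin n))) (d p c : ℝ) (β : ℝ≥0∞) (s : ℝ)
    (V : Type*) [NormedAddCommGroup V] :
    Set (EuclideanSpace ℝ (Fin n) →ₘ[volume.restrict Ω] V) :=
  {f | MemLpLoc Ω β f ∧ avNorm Ω d p c β s f < ∞}

end

end WhitneyAv

end

noncomputable section

namespace WhitneyAv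

/-! ### One-dimensional integrals -/

/-! The averaged spaces are weighted sequence spaces in disguise. Fix a Whitney-type partition of Ω
at scale `ε = c / 8`, let `δᵢ` be the boundary distance at the i-th centre and `aᵢ` the normalised
`L^β` norm of f on the i-th piece. Since a Whitney region has volume about `δᵢ ^ n`, the p-th power
of the averaged norm is comparable to `∑ (δᵢ ^ (1 - s) aᵢ) ^ p δᵢ ^ d` (`exists_tsum_coeff_le`,
`exists_lintegral_whitneyAvg_le`). The measure `δᵢ ^ d` is independent of p and s, and the weights
`δᵢ ^ (1 - s)` interpolate geometrically. Decompositions pass both ways: coefficients are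
subadditive because β ≥ 1, and a splitting of the index set lifts to f by cutting along pieces
(`coeff_cut`).

What remains is the power theorem for sequences, valid for all positive exponents. Put `G(s) = ∑
min((u₀ a) ^ p₀, s (u₁ a) ^ p₁) m`. Integrating each term against `s ^ (-η - 1)` gives the
interpolated norm (`lintegral_levelSum`), where `η = γ p / p₁`. With `s = x ^ (p₀ - p₁) t ^ p₁`, the
inequality `K(t) ≲ x` is equivalent, up to constants, to `G(s) ≲ x ^ p₀` (`ofReal_balance`). Writing
the p-th power of K by layer cake in x and substituting s for t at fixed x turns the interpolation
integral into that of G (`lintegral_lintegral_level`). No formula for K is needed, and `p₀ = p₁` is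
not a special case. -/

lemma lintegral_Ioo_rpow {r : ℝ} (hr : -1 < r) {b : ℝ} (hb : 0 < b) :
    ∫⁻ x in Ioo (0 : ℝ) b, ENNReal.ofReal (x ^ r) = ENNReal.ofReal (b ^ (r + 1) / (r + 1)) := by
  rw [← ofReal_integral_eq_lintegral_ofReal]
  · rw [← integral_Ioc_eq_integral_Ioo, ← intervalIntegral.integral_of_le hb.le,
      integral_rpow (Or.inl hr), Real.zero_rpow (by linarith), sub_zero]
  · have := (intervalIntegral.intervalIntegrable_rpow' (a := 0) (b := b) hr)
    rw [intervalIntegrable_iff_integrableOn_Ioo_of_le hb.le] at this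
    exact this
  · filter_upwards [ae_restrict_mem measurableSet_Ioo] with x hx
    exact Real.rpow_nonneg hx.1.le _

lemma lintegral_Ici_rpow {r : ℝ} (hr : r < -1) {b : ℝ} (hb : 0 < b) :
    ∫⁻ x in Ici b, ENNReal.ofReal (x ^ r) = ENNReal.ofReal (-b ^ (r + 1) / (r + 1)) := by
  rw [setLIntegral_congr Ioi_ae_eq_Ici.symm, ← ofReal_integral_eq_lintegral_ofReal]
  · rw [integral_Ioi_rpow_of_lt hr hb]
  · exact integrableOn_Ioi_rpow_of_lt hr hb
  · filter_upwards [ae_restrict_mem measurableSet_Ioi] with x hx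
    exact Real.rpow_nonneg (hb.le.trans (le_of_lt hx)) _

lemma lintegral_Ioi_eq_add {b : ℝ} (hb : 0 < b) (f : ℝ → ℝ≥0∞) :
    ∫⁻ x in Ioi (0 : ℝ), f x = (∫⁻ x in Ioo 0 b, f x) + ∫⁻ x in Ici b, f x := by
  rw [← Ioo_union_Ici_eq_Ioi hb, lintegral_union measurableSet_Ici]
  rw [Set.disjoint_left]
  intro x hx hx'
  exact absurd hx.2 (not_lt.2 hx')

/-- The layer-cake formula for a single number. It trades powers of the K-functional for the sets
where it exceeds x; the infinite value is included because K may be infinite. -/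
lemma lintegral_rpow_indicator {p : ℝ} (hp : 0 < p) (k : ℝ≥0∞) :
    ∫⁻ x in Ioi (0 : ℝ), {x : ℝ | ENNReal.ofReal x < k}.indicator
      (fun x => ENNReal.ofReal (x ^ (p - 1))) x = ENNReal.ofReal p⁻¹ * k ^ p := by
  have key : ∀ b : ℝ, 0 < b → ∫⁻ x in Ioo (0 : ℝ) b, ENNReal.ofReal (x ^ (p - 1)) =
      ENNReal.ofReal p⁻¹ * ENNReal.ofReal b ^ p := by
    intro b hb
    rw [lintegral_Ioo_rpow (by linarith) hb, ENNReal.ofReal_rpow_of_pos hb,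
      ← ENNReal.ofReal_mul (by positivity)]
    congr 1
    rw [sub_add_cancel]; field_simp
  rcases eq_or_ne k 0 with rfl | hk0
  · simp [hp]
  rcases eq_or_ne k ∞ with rfl | hk
  · simp only [ENNReal.ofReal_lt_top, ofPred_true, indicator_univ]
    rw [ENNReal.top_rpow_of_pos hp, ENNReal.mul_top (by simpa using hp), eq_top_iff]
    refine le_of_tendsto' (f := fun m : ℕ => ENNReal.ofReal p⁻¹ * ENNReal.ofReal (m + 1) ^ p)
      (x := Filter.atTop) ?_ ?_
    · have h1 : Filter.Tendsto (fun m : ℕ => ENNReal.ofReal ((m : ℝ) + 1)) Filter.atTop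
          (nhds ∞) := ENNReal.tendsto_ofReal_nhds_top.2
            (Filter.tendsto_atTop_add_const_right _ _ tendsto_natCast_atTop_atTop)
      have h2 := ((ENNReal.continuous_rpow_const (y := p)).tendsto ∞).comp h1
      rw [ENNReal.top_rpow_of_pos hp] at h2
      have h3 := ENNReal.Tendsto.const_mul (a := ENNReal.ofReal p⁻¹) h2 (Or.inl ENNReal.top_ne_zero)
      rwa [ENNReal.mul_top (by simpa using hp)] at h3
    · intro m
      rw [← key _ (by positivity)]
      exact lintegral_mono_set Ioo_subset_Ioi_self
  · lift k to ℝ≥0 using hk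
    have hk0' : 0 < (k : ℝ) := by
      have : k ≠ 0 := by simpa using hk0
      exact_mod_cast pos_iff_ne_zero.2 this
    have h := key k hk0'
    rw [ENNReal.ofReal_coe_nnreal] at h
    have hm : MeasurableSet {x : ℝ | ENNReal.ofReal x < k} :=
      measurableSet_lt ENNReal.measurable_ofReal measurable_const
    rw [← h, lintegral_indicator hm, Measure.restrict_restrict hm]
    congr 2
    ext x
    simp only [mem_inter_iff, mem_ofPred_eq, mem_Ioi, mem_Ioo]
    constructor
    · rintro ⟨h1, h2⟩
      refine ⟨h2, ?_⟩
      rw [← ENNReal.ofReal_coe_nnreal] at h1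
      exact ((ENNReal.ofReal_lt_ofReal_iff_of_nonneg h2.le).1 h1)
    · rintro ⟨h1, h2⟩
      refine ⟨?_, h1⟩
      rw [← ENNReal.ofReal_coe_nnreal]
      exact (ENNReal.ofReal_lt_ofReal_iff_of_nonneg h1.le).2 h2

/-- The minimum switches branch at `s = A / B`. The condition `0 < η < 1` makes the left part
converge at 0 and the right part at infinity. -/
lemma lintegral_rpow_mul_min {η : ℝ} (hη0 : 0 < η) (hη1 : η < 1) {A B : ℝ≥0∞}
    (hA : A ≠ ∞) (hB : B ≠ ∞) :
    ∫⁻ s in Ioi (0 : ℝ), ENNReal.ofReal (s ^ (-η - 1)) * min A (ENNReal.ofReal s * B) =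
      ENNReal.ofReal (η⁻¹ + (1 - η)⁻¹) * (A ^ (1 - η) * B ^ η) := by
  have h1η : 0 < 1 - η := by linarith
  rcases eq_or_ne A 0 with rfl | hA0
  · simp [h1η]
  rcases eq_or_ne B 0 with rfl | hB0
  · simp [hη0]
  obtain ⟨a, ha, rfl⟩ : ∃ a : ℝ, 0 < a ∧ A = ENNReal.ofReal a :=
    ⟨A.toReal, ENNReal.toReal_pos hA0 hA, (ENNReal.ofReal_toReal hA).symm⟩
  obtain ⟨b, hb, rfl⟩ : ∃ b : ℝ, 0 < b ∧ B = ENNReal.ofReal b :=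
    ⟨B.toReal, ENNReal.toReal_pos hB0 hB, (ENNReal.ofReal_toReal hB).symm⟩
  have hab : 0 < a / b := by positivity
  rw [lintegral_Ioi_eq_add hab]
  have e1 : ∫⁻ s in Ioo 0 (a / b), ENNReal.ofReal (s ^ (-η - 1)) *
      min (ENNReal.ofReal a) (ENNReal.ofReal s * ENNReal.ofReal b) =
      ∫⁻ s in Ioo 0 (a / b), ENNReal.ofReal b * ENNReal.ofReal (s ^ (-η)) := by
    refine setLIntegral_congr_fun measurableSet_Ioo fun s hs => ?_
    have hs0 : 0 < s := hs.1
    have : s * b ≤ a := ((lt_div_iff₀ hb).1 hs.2).le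
    rw [← ENNReal.ofReal_mul hs0.le, min_eq_right (ENNReal.ofReal_le_ofReal this),
      ← ENNReal.ofReal_mul (by positivity), ← ENNReal.ofReal_mul hb.le]
    congr 1
    rw [Real.rpow_sub_one hs0.ne']; field_simp
  have e2 : ∫⁻ s in Ici (a / b), ENNReal.ofReal (s ^ (-η - 1)) *
      min (ENNReal.ofReal a) (ENNReal.ofReal s * ENNReal.ofReal b) =
      ∫⁻ s in Ici (a / b), ENNReal.ofReal a * ENNReal.ofReal (s ^ (-η - 1)) := by
    refine setLIntegral_congr_fun measurableSet_Ici fun s hs => ?_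
    have hs0 : 0 < s := hab.trans_le hs
    have : a ≤ s * b := (div_le_iff₀ hb).1 hs
    rw [← ENNReal.ofReal_mul hs0.le, min_eq_left (ENNReal.ofReal_le_ofReal this), mul_comm]
  rw [e1, e2, lintegral_const_mul' _ _ ENNReal.ofReal_ne_top,
    lintegral_const_mul' _ _ ENNReal.ofReal_ne_top, lintegral_Ioo_rpow (by linarith) hab,
    lintegral_Ici_rpow (by linarith) hab, ENNReal.ofReal_rpow_of_pos ha,
    ENNReal.ofReal_rpow_of_pos hb, ← ENNReal.ofReal_mul hb.le, ← ENNReal.ofReal_mul ha.le,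
    ← ENNReal.ofReal_mul (by positivity), ← ENNReal.ofReal_mul (by positivity),
    ← ENNReal.ofReal_add]
  · congr 1
    have x1 : (a / b) ^ (-η + 1) = a ^ (1 - η) * b ^ η / b := by
      rw [Real.div_rpow ha.le hb.le, show -η + 1 = 1 - η by ring, Real.rpow_sub hb,
        Real.rpow_one]; field_simp
    have x2 : (a / b) ^ (-η - 1 + 1) = a ^ (1 - η) * b ^ η / a := by
      rw [Real.div_rpow ha.le hb.le, show -η - 1 + 1 = -η by ring, Real.rpow_sub ha,
        Real.rpow_one, Real.rpow_neg ha.le, Real.rpow_neg hb.le]; field_simp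
    rw [x1, x2, show -η - 1 + 1 = -η by ring, show -η + 1 = 1 - η by ring]
    field_simp
    ring
  · have : 0 < -η + 1 := by linarith
    positivity
  · rw [show -η - 1 + 1 = -η by ring, neg_div_neg_eq]
    positivity

/-- The substitution `t = (s * L) ^ (1 / q)` in an integral over the half-line. -/
lemma lintegral_Ioi_comp_rpow {q L η : ℝ} (hq : 0 < q) (hL : 0 < L) (F : ℝ → ℝ≥0∞) :
    ∫⁻ t in Ioi (0 : ℝ), ENNReal.ofReal (t ^ (-(η * q) - 1)) * F (L⁻¹ * t ^ q) =
      ENNReal.ofReal (q⁻¹ * L ^ (-η)) *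
        ∫⁻ s in Ioi (0 : ℝ), ENNReal.ofReal (s ^ (-η - 1)) * F s := by
  have himg : (fun s : ℝ => (s * L) ^ q⁻¹) '' Ioi 0 = Ioi 0 := by
    ext t
    simp only [mem_image, mem_Ioi]
    constructor
    · rintro ⟨s, hs, rfl⟩
      positivity
    · intro ht
      refine ⟨t ^ q / L, by positivity, ?_⟩
      rw [div_mul_cancel₀ _ hL.ne', Real.rpow_rpow_inv ht.le hq.ne']
  have hder : ∀ s ∈ Ioi (0 : ℝ), HasDerivWithinAt (fun s : ℝ => (s * L) ^ q⁻¹)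
      (L * q⁻¹ * (s * L) ^ (q⁻¹ - 1)) (Ioi 0) s := by
    intro s hs
    have hs0 : (0 : ℝ) < s := hs
    have h1 : HasDerivAt (fun s : ℝ => s * L) L s := by simpa using (hasDerivAt_id s).mul_const L
    exact (h1.rpow_const (Or.inl (by positivity))).hasDerivWithinAt
  have hinj : InjOn (fun s : ℝ => (s * L) ^ q⁻¹) (Ioi 0) := by
    intro s hs s' hs' h
    have hs0 : (0 : ℝ) < s := hs
    have hs0' : (0 : ℝ) < s' := hs'
    have := (Real.rpow_left_inj (by positivity) (by positivity) (inv_ne_zero hq.ne')).1 h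
    exact mul_right_cancel₀ hL.ne' this
  conv_lhs => rw [← himg]
  rw [lintegral_image_eq_lintegral_abs_deriv_mul measurableSet_Ioi hder hinj,
    ← lintegral_const_mul' _ _ ENNReal.ofReal_ne_top]
  refine setLIntegral_congr_fun measurableSet_Ioi fun s hs => ?_
  have hs0 : (0 : ℝ) < s := hs
  rw [Real.rpow_inv_rpow (by positivity) hq.ne', show L⁻¹ * (s * L) = s by field_simp,
    ← mul_assoc, ← mul_assoc, ← ENNReal.ofReal_mul (abs_nonneg _),
    ← ENNReal.ofReal_mul (by positivity)]
  congr 2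
  rw [abs_of_pos (by positivity), ← Real.rpow_mul (by positivity), mul_assoc,
    ← Real.rpow_add (by positivity),
    show q⁻¹ - 1 + q⁻¹ * (-(η * q) - 1) = -η - 1 by field_simp; ring,
    Real.mul_rpow hs0.le hL.le, Real.rpow_sub_one hL.ne']
  field_simp

/-- The two-dimensional change of variables behind the power theorem for the `K`-method. -/
lemma lintegral_lintegral_level {p₀ p₁ p γ η : ℝ} (hp₀ : 0 < p₀) (hp₁ : 0 < p₁)
    (hη : η * p₁ = γ * p) (hp : p = (1 - η) * p₀ + η * p₁) {H : ℝ → ℝ≥0∞} (hH : Measurable H) :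
    ∫⁻ t in Ioi (0 : ℝ), ENNReal.ofReal (t ^ (-(γ * p) - 1)) *
      ∫⁻ x in Ioi (0 : ℝ), {x : ℝ | ENNReal.ofReal x < H (x ^ (p₀ - p₁) * t ^ p₁) ^ p₀⁻¹}.indicator
        (fun x => ENNReal.ofReal (x ^ (p - 1))) x =
    ENNReal.ofReal (p₀⁻¹ * p₁⁻¹) *
      ∫⁻ s in Ioi (0 : ℝ), ENNReal.ofReal (s ^ (-η - 1)) * H s := by
  have hmeas : MeasurableSet {z : ℝ × ℝ |
      ENNReal.ofReal z.2 < H (z.2 ^ (p₀ - p₁) * z.1 ^ p₁) ^ p₀⁻¹} := by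
    refine measurableSet_lt (by fun_prop) ?_
    exact (hH.comp (by fun_prop)).pow_const _
  have hmeas' : MeasurableSet {z : ℝ × ℝ | ENNReal.ofReal z.2 < H z.1 ^ p₀⁻¹} :=
    measurableSet_lt (by fun_prop) ((hH.comp measurable_fst).pow_const _)
  have step1 : ∀ t : ℝ, ENNReal.ofReal (t ^ (-(γ * p) - 1)) *
      ∫⁻ x in Ioi (0 : ℝ), {x : ℝ | ENNReal.ofReal x < H (x ^ (p₀ - p₁) * t ^ p₁) ^ p₀⁻¹}.indicator
        (fun x => ENNReal.ofReal (x ^ (p - 1))) x =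
      ∫⁻ x in Ioi (0 : ℝ), ENNReal.ofReal (t ^ (-(γ * p) - 1)) *
        {x : ℝ | ENNReal.ofReal x < H (x ^ (p₀ - p₁) * t ^ p₁) ^ p₀⁻¹}.indicator
        (fun x => ENNReal.ofReal (x ^ (p - 1))) x :=
    fun t => (lintegral_const_mul' _ _ ENNReal.ofReal_ne_top).symm
  simp_rw [step1]
  rw [lintegral_lintegral_swap]
  swap
  · refine Measurable.aemeasurable ?_
    have : (Function.uncurry fun t x : ℝ => ENNReal.ofReal (t ^ (-(γ * p) - 1)) *
        {x : ℝ | ENNReal.ofReal x < H (x ^ (p₀ - p₁) * t ^ p₁) ^ p₀⁻¹}.indicator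
        (fun x => ENNReal.ofReal (x ^ (p - 1))) x) = fun z : ℝ × ℝ =>
        ENNReal.ofReal (z.1 ^ (-(γ * p) - 1)) * {z : ℝ × ℝ |
          ENNReal.ofReal z.2 < H (z.2 ^ (p₀ - p₁) * z.1 ^ p₁) ^ p₀⁻¹}.indicator
          (fun z => ENNReal.ofReal (z.2 ^ (p - 1))) z := by
      ext ⟨t, x⟩
      simp [Function.uncurry, indicator]
    rw [this]
    exact Measurable.mul (by fun_prop) (Measurable.indicator (by fun_prop) hmeas)
  -- At fixed x, substitute `s = x ^ (p₀ - p₁) * t ^ p₁`. The Jacobian factor `x ^ (-η (p₁ - p₀))`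
  -- turns `x ^ (p - 1)` into `x ^ (p₀ - 1)`, so the x-integral then yields the first power of `H
  -- s`.
  have step2 : ∀ x ∈ Ioi (0 : ℝ), ∫⁻ t in Ioi (0 : ℝ), ENNReal.ofReal (t ^ (-(γ * p) - 1)) *
        {x : ℝ | ENNReal.ofReal x < H (x ^ (p₀ - p₁) * t ^ p₁) ^ p₀⁻¹}.indicator
        (fun x => ENNReal.ofReal (x ^ (p - 1))) x =
      ∫⁻ s in Ioi (0 : ℝ), ENNReal.ofReal p₁⁻¹ * (ENNReal.ofReal (s ^ (-η - 1)) *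
        {x : ℝ | ENNReal.ofReal x < H s ^ p₀⁻¹}.indicator
          (fun x => ENNReal.ofReal (x ^ (p₀ - 1))) x) := by
    intro x hx
    have hx0 : (0 : ℝ) < x := hx
    have h := lintegral_Ioi_comp_rpow (q := p₁) (L := x ^ (p₁ - p₀)) (η := η) hp₁ (by positivity)
      (fun s => {x : ℝ | ENNReal.ofReal x < H s ^ p₀⁻¹}.indicator
        (fun x => ENNReal.ofReal (x ^ (p - 1))) x)
    rw [← Real.rpow_neg hx0.le, neg_sub, hη] at h
    refine Eq.trans h ?_
    rw [← lintegral_const_mul' _ _ ENNReal.ofReal_ne_top]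
    refine lintegral_congr fun s => ?_
    by_cases hs : ENNReal.ofReal x < H s ^ p₀⁻¹
    · simp only [indicator, mem_ofPred_eq, hs, if_true]
      rw [ENNReal.ofReal_mul (by positivity), mul_assoc,
        mul_left_comm (ENNReal.ofReal ((x ^ (p₁ - p₀)) ^ (-η))),
        ← ENNReal.ofReal_mul (by positivity), ← Real.rpow_mul hx0.le, ← Real.rpow_add hx0]
      congr 4
      rw [hp]; ring
    · simp [indicator, hs]
  rw [setLIntegral_congr_fun measurableSet_Ioi step2, lintegral_lintegral_swap]
  swap
  · refine Measurable.aemeasurable ?_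
    have : (Function.uncurry fun x s : ℝ => ENNReal.ofReal p₁⁻¹ * (ENNReal.ofReal (s ^ (-η - 1)) *
        {x : ℝ | ENNReal.ofReal x < H s ^ p₀⁻¹}.indicator
          (fun x => ENNReal.ofReal (x ^ (p₀ - 1))) x)) = fun z : ℝ × ℝ =>
        ENNReal.ofReal p₁⁻¹ * (ENNReal.ofReal (z.2 ^ (-η - 1)) * {z : ℝ × ℝ |
          ENNReal.ofReal z.2 < H z.1 ^ p₀⁻¹}.indicator
          (fun z => ENNReal.ofReal (z.2 ^ (p₀ - 1))) z.swap) := by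
      ext ⟨t, x⟩
      simp [Function.uncurry, indicator]
    rw [this]
    refine Measurable.mul (by fun_prop) (Measurable.mul (by fun_prop) ?_)
    exact (Measurable.indicator (by fun_prop) hmeas').comp measurable_swap
  rw [← lintegral_const_mul' _ _ ENNReal.ofReal_ne_top]
  refine lintegral_congr fun s => ?_
  rw [lintegral_const_mul' _ _ ENNReal.ofReal_ne_top,
    lintegral_const_mul' _ _ ENNReal.ofReal_ne_top, lintegral_rpow_indicator hp₀,
    ENNReal.rpow_inv_rpow hp₀.ne', ENNReal.ofReal_mul (by positivity)]
  ring

/-! ### Weighted sequence spaces -/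

section LevelSum

variable {ι : Type*}

/-- The `K`-functional of `a` between the `p₀`-th power of `ℓ^{p₀}(u₀, m)` and the `p₁`-th power
of `ℓ^{p₁}(u₁, m)`, up to constants. -/
def levelSum (p₀ p₁ : ℝ) (u₀ u₁ m a : ι → ℝ≥0∞) (s : ℝ) : ℝ≥0∞ :=
  ∑' i, min ((u₀ i * a i) ^ p₀) (ENNReal.ofReal s * (u₁ i * a i) ^ p₁) * m i

variable {p₀ p₁ p γ η : ℝ} {u₀ u₁ m a : ι → ℝ≥0∞}

lemma measurable_levelSum [Countable ι] : Measurable (levelSum p₀ p₁ u₀ u₁ m a) := by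
  unfold levelSum
  refine Measurable.tsum fun i => ?_
  fun_prop

lemma lintegral_levelSum [Countable ι] (hp₀ : 0 < p₀) (hp₁ : 0 < p₁) (hη0 : 0 < η) (hη1 : η < 1)
    (h0 : p₀ * (1 - η) = (1 - γ) * p) (h1 : p₁ * η = γ * p) (hp : 0 < p)
    (hu₀ : ∀ i, u₀ i ≠ ∞) (hu₁ : ∀ i, u₁ i ≠ ∞) (ha : ∀ i, a i ≠ ∞) :
    ∫⁻ s in Ioi (0 : ℝ), ENNReal.ofReal (s ^ (-η - 1)) * levelSum p₀ p₁ u₀ u₁ m a s =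
      ENNReal.ofReal (η⁻¹ + (1 - η)⁻¹) *
        ∑' i, (u₀ i ^ (1 - γ) * u₁ i ^ γ * a i) ^ p * m i := by
  unfold levelSum
  simp_rw [← ENNReal.tsum_mul_left]
  rw [lintegral_tsum (fun i => Measurable.aemeasurable (by fun_prop))]
  refine tsum_congr fun i => ?_
  have hA : (u₀ i * a i) ^ p₀ ≠ ∞ :=
    ENNReal.rpow_ne_top_of_nonneg hp₀.le (ENNReal.mul_ne_top (hu₀ i) (ha i))
  have hB : (u₁ i * a i) ^ p₁ ≠ ∞ :=
    ENNReal.rpow_ne_top_of_nonneg hp₁.le (ENNReal.mul_ne_top (hu₁ i) (ha i))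
  have := lintegral_rpow_mul_min hη0 hη1 hA hB
  simp_rw [← mul_assoc]
  simp_rw [← mul_assoc] at this
  rw [lintegral_mul_const _ (by fun_prop), this]
  congr 1
  rw [mul_assoc]
  congr 1
  rw [← ENNReal.rpow_mul, ← ENNReal.rpow_mul, h0, h1]
  have hγ0 : 0 ≤ γ * p := by rw [← h1]; positivity
  have hγ1 : 0 ≤ (1 - γ) * p := by rw [← h0]; exact mul_nonneg hp₀.le (by linarith)
  rw [ENNReal.mul_rpow_of_nonneg _ _ hγ0, ENNReal.mul_rpow_of_nonneg _ _ hγ1,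
    ENNReal.mul_rpow_of_nonneg _ _ hp.le, ENNReal.mul_rpow_of_nonneg _ _ hp.le,
    ← ENNReal.rpow_mul, ← ENNReal.rpow_mul]
  have : a i ^ p = a i ^ ((1 - γ) * p) * a i ^ (γ * p) := by
    rw [← ENNReal.rpow_add_of_nonneg _ _ hγ1 hγ0]
    congr 1; ring
  rw [this]
  ring

/-- The set on which the first entry realises the minimum in `levelSum`. -/
def levelSet (p₀ p₁ : ℝ) (u₀ u₁ a : ι → ℝ≥0∞) (s : ℝ) : Set ι :=
  {i | (u₀ i * a i) ^ p₀ ≤ ENNReal.ofReal s * (u₁ i * a i) ^ p₁}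

lemma tsum_levelSet_le (s : ℝ) :
    ∑' i, (levelSet p₀ p₁ u₀ u₁ a s).indicator (fun i => (u₀ i * a i) ^ p₀ * m i) i ≤
      levelSum p₀ p₁ u₀ u₁ m a s := by
  refine ENNReal.tsum_le_tsum fun i => ?_
  by_cases h : i ∈ levelSet p₀ p₁ u₀ u₁ a s
  · rw [indicator_of_mem h, min_eq_left h]
  · rw [indicator_of_notMem h]; exact zero_le

lemma tsum_levelSet_compl_le (s : ℝ) :
    ENNReal.ofReal s *
      ∑' i, (levelSet p₀ p₁ u₀ u₁ a s)ᶜ.indicator (fun i => (u₁ i * a i) ^ p₁ * m i) i ≤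
      levelSum p₀ p₁ u₀ u₁ m a s := by
  rw [← ENNReal.tsum_mul_left]
  refine ENNReal.tsum_le_tsum fun i => ?_
  by_cases h : i ∈ (levelSet p₀ p₁ u₀ u₁ a s)ᶜ
  · rw [indicator_of_mem h, min_eq_right (lt_of_not_ge fun h' => h h').le, mul_assoc]
  · rw [indicator_of_notMem h]; simp

/-- A finite integral forces `levelSum` to be finite at some s > 0, and the level set for that s
does the splitting. This gives membership in the sum space. -/
lemma exists_levelSet_ne_top [Countable ι]
    (h : ∫⁻ s in Ioi (0 : ℝ), ENNReal.ofReal (s ^ (-η - 1)) * levelSum p₀ p₁ u₀ u₁ m a s ≠ ∞) :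
    ∃ I : Set ι, ∑' i, I.indicator (fun i => (u₀ i * a i) ^ p₀ * m i) i ≠ ∞ ∧
      ∑' i, Iᶜ.indicator (fun i => (u₁ i * a i) ^ p₁ * m i) i ≠ ∞ := by
  have hm : Measurable fun s : ℝ => ENNReal.ofReal (s ^ (-η - 1)) * levelSum p₀ p₁ u₀ u₁ m a s :=
    Measurable.mul (by fun_prop) measurable_levelSum
  have hae := (ae_lt_top hm h).and (ae_restrict_mem (μ := volume) measurableSet_Ioi)
  have : (ae (volume.restrict (Ioi (0 : ℝ)))).NeBot := by
    rw [ae_neBot, Ne, Measure.restrict_eq_zero]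
    simp
  obtain ⟨s, hs, hs0⟩ := hae.exists
  have hs0 : (0 : ℝ) < s := hs0
  have hG : levelSum p₀ p₁ u₀ u₁ m a s ≠ ∞ := by
    intro h
    rw [h, ENNReal.mul_top (by simpa using Real.rpow_pos_of_pos hs0 _)] at hs
    exact lt_irrefl _ hs
  refine ⟨levelSet p₀ p₁ u₀ u₁ a s, ne_top_of_le_ne_top hG (tsum_levelSet_le s), fun h => ?_⟩
  have := tsum_levelSet_compl_le (p₀ := p₀) (p₁ := p₁) (u₀ := u₀) (u₁ := u₁) (m := m) (a := a) s
  rw [h, ENNReal.mul_top (by simpa using hs0)] at this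
  exact hG (top_le_iff.1 this)

/-- The reason for the choice `s = x ^ (p₀ - p₁) * t ^ p₁`: a bound by `x ^ p₀` on both halves of
`levelSum` becomes a bound by x on the first norm and by x / t on the second. -/
lemma ofReal_balance {x t : ℝ} (hx : 0 < x) (ht : 0 < t) :
    ENNReal.ofReal (x ^ (p₀ - p₁) * t ^ p₁) * (ENNReal.ofReal x / ENNReal.ofReal t) ^ p₁ =
      ENNReal.ofReal x ^ p₀ := by
  rw [← ENNReal.ofReal_div_of_pos ht, ENNReal.ofReal_rpow_of_pos (by positivity),
    ENNReal.ofReal_rpow_of_pos hx, ← ENNReal.ofReal_mul (by positivity)]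
  congr 1
  rw [Real.div_rpow hx.le ht.le, Real.rpow_sub hx]
  field_simp

lemma ofReal_rpow_mul_rpow {t : ℝ} (ht : 0 < t) (hp : 0 < p) (k : ℝ≥0∞) :
    (ENNReal.ofReal (t ^ (-γ)) * k) ^ p * ENNReal.ofReal t⁻¹ =
      ENNReal.ofReal (t ^ (-(γ * p) - 1)) * k ^ p := by
  rw [ENNReal.mul_rpow_of_nonneg _ _ hp.le, ENNReal.ofReal_rpow_of_pos (by positivity),
    mul_right_comm, ← ENNReal.ofReal_mul (by positivity)]
  congr 2
  rw [← Real.rpow_mul ht.le, Real.rpow_sub_one ht.ne', neg_mul, div_eq_mul_inv]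

/-- If `k` bounds from below every scheme of splitting the sequence `a`, then its interpolation
integral is controlled by that of `levelSum`. -/
lemma lintegral_le_of_split [Countable ι] (hp₀ : 0 < p₀) (hp₁ : 0 < p₁) (hp' : 0 < p)
    (hη : η * p₁ = γ * p) (hp : p = (1 - η) * p₀ + η * p₁) {k : ℝ → ℝ≥0∞} {C : ℝ≥0∞}
    (hC0 : C ≠ 0) (hC : C ≠ ∞)
    (hk : ∀ (I : Set ι) (t : ℝ), 0 < t →
      ∑' i, I.indicator (fun i => (u₀ i * a i) ^ p₀ * m i) i ≠ ∞ →
      ∑' i, Iᶜ.indicator (fun i => (u₁ i * a i) ^ p₁ * m i) i ≠ ∞ →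
      k t ≤ C * ((∑' i, I.indicator (fun i => (u₀ i * a i) ^ p₀ * m i) i) ^ (1 / p₀) +
        ENNReal.ofReal t * (∑' i, Iᶜ.indicator (fun i => (u₁ i * a i) ^ p₁ * m i) i) ^ (1 / p₁))) :
    ∫⁻ t in Ioi (0 : ℝ), (ENNReal.ofReal (t ^ (-γ)) * k t) ^ p * ENNReal.ofReal t⁻¹ ≤
      (2 * C) ^ p * ENNReal.ofReal p * ENNReal.ofReal (p₀⁻¹ * p₁⁻¹) *
        ∫⁻ s in Ioi (0 : ℝ), ENNReal.ofReal (s ^ (-η - 1)) * levelSum p₀ p₁ u₀ u₁ m a s := by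
  have h2C0 : 2 * C ≠ 0 := mul_ne_zero two_ne_zero hC0
  have h2C : 2 * C ≠ ∞ := ENNReal.mul_ne_top ENNReal.ofNat_ne_top hC
  have key : ∀ t : ℝ, 0 < t → ∀ x : ℝ, 0 < x →
      levelSum p₀ p₁ u₀ u₁ m a (x ^ (p₀ - p₁) * t ^ p₁) ^ p₀⁻¹ ≤ ENNReal.ofReal x →
      k t ≤ 2 * C * ENNReal.ofReal x := by
    intro t ht x hx hle
    set s := x ^ (p₀ - p₁) * t ^ p₁ with hs
    have hs0 : 0 < s := by positivity
    have hG : levelSum p₀ p₁ u₀ u₁ m a s ≤ ENNReal.ofReal x ^ p₀ :=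
      (ENNReal.rpow_inv_le_iff hp₀).1 hle
    have hX := (tsum_levelSet_le (p₀ := p₀) (p₁ := p₁) (u₀ := u₀) (u₁ := u₁) (m := m) (a := a)
      s).trans hG
    have hY := (tsum_levelSet_compl_le (p₀ := p₀) (p₁ := p₁) (u₀ := u₀) (u₁ := u₁) (m := m)
      (a := a) s).trans hG
    rw [← ofReal_balance (p₁ := p₁) hx ht, ← hs] at hY
    have hY := (ENNReal.mul_le_mul_iff_right (by simpa using hs0) ENNReal.ofReal_ne_top).1 hY
    have ht0 : ENNReal.ofReal t ≠ 0 := by simpa using ht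
    have hxt : ENNReal.ofReal x / ENNReal.ofReal t ≠ ∞ := ENNReal.div_ne_top ENNReal.ofReal_ne_top ht0
    refine (hk _ t ht (ne_top_of_le_ne_top (by finiteness) hX)
      (ne_top_of_le_ne_top (ENNReal.rpow_ne_top_of_nonneg hp₁.le hxt) hY)).trans ?_
    rw [mul_comm 2 C, mul_assoc, two_mul]
    gcongr
    · rw [one_div]; exact (ENNReal.rpow_inv_le_iff hp₀).2 hX
    · rw [one_div]
      refine (mul_le_mul_right ((ENNReal.rpow_inv_le_iff hp₁).2 hY) _).trans ?_
      rw [ENNReal.mul_div_cancel ht0 ENNReal.ofReal_ne_top]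
  have hpt : ∀ t ∈ Ioi (0 : ℝ), (ENNReal.ofReal (t ^ (-γ)) * k t) ^ p * ENNReal.ofReal t⁻¹ ≤
      (2 * C) ^ p * ENNReal.ofReal p * (ENNReal.ofReal (t ^ (-(γ * p) - 1)) *
      ∫⁻ x in Ioi (0 : ℝ), {x : ℝ | ENNReal.ofReal x <
        levelSum p₀ p₁ u₀ u₁ m a (x ^ (p₀ - p₁) * t ^ p₁) ^ p₀⁻¹}.indicator
        (fun x => ENNReal.ofReal (x ^ (p - 1))) x) := by
    intro t ht
    have ht : 0 < t := ht
    rw [ofReal_rpow_mul_rpow ht hp', mul_left_comm]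
    gcongr
    -- After dividing by 2C, layer cake reduces the estimate to the implication `x < k t / (2C)` ⟹
    -- `x < levelSum ^ (1 / p₀)`, the contrapositive of `key`.
    have h1 : k t ^ p = (2 * C) ^ p * ENNReal.ofReal p *
        (ENNReal.ofReal p⁻¹ * (k t / (2 * C)) ^ p) := by
      rw [mul_assoc, ← mul_assoc (ENNReal.ofReal p), ← ENNReal.ofReal_mul hp'.le,
        mul_inv_cancel₀ hp'.ne', ENNReal.ofReal_one, one_mul, ← ENNReal.mul_rpow_of_nonneg _ _ hp'.le,
        ENNReal.mul_div_cancel h2C0 h2C]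
    rw [h1, ← lintegral_rpow_indicator hp']
    refine mul_le_mul_right ?_ _
    refine setLIntegral_mono' measurableSet_Ioi fun x hx => ?_
    have hx : 0 < x := hx
    simp only [indicator, mem_ofPred_eq]
    split_ifs with h1 h2
    · exact le_rfl
    · refine absurd (key t ht x hx (not_lt.1 h2)) (not_le.2 ?_)
      rw [mul_comm]
      exact (ENNReal.lt_div_iff_mul_lt (Or.inl h2C0) (Or.inl h2C)).1 h1
    · exact zero_le
    · exact le_rfl
  refine (setLIntegral_mono' measurableSet_Ioi hpt).trans ?_
  rw [lintegral_const_mul' _ _ (by finiteness),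
    lintegral_lintegral_level hp₀ hp₁ hη hp measurable_levelSum, ← mul_assoc]

/-- At each index `a` is at most twice the larger of the two summands; bound the minimum by the
branch belonging to that summand. -/
lemma levelSum_le_add (hp₀ : 0 < p₀) (hp₁ : 0 < p₁) {a₀ a₁ : ι → ℝ≥0∞}
    (ha : ∀ i, a i ≤ a₀ i + a₁ i) (s : ℝ) :
    levelSum p₀ p₁ u₀ u₁ m a s ≤ 2 ^ p₀ * ∑' i, (u₀ i * a₀ i) ^ p₀ * m i +
      ENNReal.ofReal s * (2 ^ p₁ * ∑' i, (u₁ i * a₁ i) ^ p₁ * m i) := by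
  simp_rw [← ENNReal.tsum_mul_left]
  rw [← ENNReal.tsum_add]
  refine ENNReal.tsum_le_tsum fun i => ?_
  have e : ∀ (q : ℝ), 0 < q → ∀ u b : ℝ≥0∞, a i ≤ 2 * b → (u * a i) ^ q ≤ 2 ^ q * (u * b) ^ q := by
    intro q hq u b hb
    rw [← ENNReal.mul_rpow_of_nonneg _ _ hq.le, mul_left_comm]
    gcongr
  rcases le_total (a₁ i) (a₀ i) with h | h
  · refine le_add_right ?_
    rw [← mul_assoc]
    gcongr
    refine (min_le_left _ _).trans (e p₀ hp₀ _ _ ((ha i).trans ?_))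
    rw [two_mul]; gcongr
  · refine le_add_left ?_
    rw [← mul_assoc, ← mul_assoc]
    gcongr
    refine (min_le_right _ _).trans ?_
    rw [mul_assoc]
    gcongr
    refine (e p₁ hp₁ _ _ ((ha i).trans ?_))
    rw [two_mul]; gcongr

/-- If every value above `k` is attained by some splitting of the sequence `a`, then the
interpolation integral of `k` controls that of `levelSum`. -/
lemma le_lintegral_of_split [Countable ι] (hp₀ : 0 < p₀) (hp₁ : 0 < p₁) (hp' : 0 < p)
    (hη : η * p₁ = γ * p) (hp : p = (1 - η) * p₀ + η * p₁) {k : ℝ → ℝ≥0∞} {C : ℝ≥0∞}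
    (hC0 : C ≠ 0) (hC : C ≠ ∞)
    (hk : ∀ (t : ℝ), 0 < t → ∀ v : ℝ≥0∞, k t < v → ∃ a₀ a₁ : ι → ℝ≥0∞, (∀ i, a i ≤ a₀ i + a₁ i) ∧
      ∑' i, (u₀ i * a₀ i) ^ p₀ * m i ≤ (C * v) ^ p₀ ∧
      ∑' i, (u₁ i * a₁ i) ^ p₁ * m i ≤ (C * (v / ENNReal.ofReal t)) ^ p₁) :
    ∫⁻ s in Ioi (0 : ℝ), ENNReal.ofReal (s ^ (-η - 1)) * levelSum p₀ p₁ u₀ u₁ m a s ≤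
      ((2 * C) ^ p₀ + (2 * C) ^ p₁) * (ENNReal.ofReal (p₀ * p₁) * (ENNReal.ofReal p⁻¹ * 2 ^ p)) *
      ∫⁻ t in Ioi (0 : ℝ), (ENNReal.ofReal (t ^ (-γ)) * k t) ^ p * ENNReal.ofReal t⁻¹ := by
  set D := (2 * C) ^ p₀ + (2 * C) ^ p₁ with hD
  have h2C0 : 2 * C ≠ 0 := mul_ne_zero two_ne_zero hC0
  have h2C : 2 * C ≠ ∞ := ENNReal.mul_ne_top ENNReal.ofNat_ne_top hC
  have hDtop : D ≠ ∞ := ENNReal.add_ne_top.2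
    ⟨ENNReal.rpow_ne_top_of_nonneg hp₀.le h2C, ENNReal.rpow_ne_top_of_nonneg hp₁.le h2C⟩
  have hD0 : D ≠ 0 := by
    have := (ENNReal.rpow_pos (p := p₀) (pos_iff_ne_zero.2 h2C0) h2C).ne'
    simp [hD, this]
  have key : ∀ t : ℝ, 0 < t → ∀ x : ℝ, 0 < x → k t < ENNReal.ofReal x →
      levelSum p₀ p₁ u₀ u₁ m a (x ^ (p₀ - p₁) * t ^ p₁) ≤ D * ENNReal.ofReal x ^ p₀ := by
    intro t ht x hx hlt
    obtain ⟨a₀, a₁, ha, h0, h1⟩ := hk t ht _ hlt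
    refine (levelSum_le_add hp₀ hp₁ ha _).trans ?_
    rw [hD, add_mul]
    gcongr ?_ + ?_
    · rw [ENNReal.mul_rpow_of_nonneg 2 C hp₀.le, mul_assoc, ← ENNReal.mul_rpow_of_nonneg _ _ hp₀.le]
      gcongr
    · rw [← ofReal_balance (p₁ := p₁) hx ht, mul_left_comm, ENNReal.mul_rpow_of_nonneg 2 C hp₁.le,
        mul_assoc, mul_left_comm (C ^ p₁), ← ENNReal.mul_rpow_of_nonneg C _ hp₁.le]
      gcongr
  have hpt : ∀ t ∈ Ioi (0 : ℝ), ENNReal.ofReal (t ^ (-(γ * p) - 1)) *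
      ∫⁻ x in Ioi (0 : ℝ), {x : ℝ | ENNReal.ofReal x <
        (D⁻¹ * levelSum p₀ p₁ u₀ u₁ m a (x ^ (p₀ - p₁) * t ^ p₁)) ^ p₀⁻¹}.indicator
        (fun x => ENNReal.ofReal (x ^ (p - 1))) x ≤ ENNReal.ofReal p⁻¹ * 2 ^ p *
      ((ENNReal.ofReal (t ^ (-γ)) * k t) ^ p * ENNReal.ofReal t⁻¹) := by
    intro t ht
    have ht : 0 < t := ht
    rw [ofReal_rpow_mul_rpow ht hp', mul_left_comm]
    gcongr
    rw [mul_assoc, ← ENNReal.mul_rpow_of_nonneg _ _ hp'.le, ← lintegral_rpow_indicator hp']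
    refine setLIntegral_mono' measurableSet_Ioi fun x hx => ?_
    have hx : 0 < x := hx
    simp only [indicator, mem_ofPred_eq]
    split_ifs with h1 h2
    · exact le_rfl
    · exfalso
      -- `key` needs the strict inequality `k t < x`, so it gives only `x ≤ k t`. The factor 2 in
      -- the target closes the gap: `2 k t ≤ x ≤ k t` is impossible for `k t` positive and finite.
      have hx' : ENNReal.ofReal x ≤ k t := by
        by_contra hcon
        have h3 := key t ht x hx (not_le.1 hcon)
        refine absurd h1 (not_lt.2 ?_)
        rw [ENNReal.rpow_inv_le_iff hp₀, mul_comm, ← div_eq_mul_inv]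
        exact ENNReal.div_le_of_le_mul' h3
      rw [not_lt] at h2
      have hx0 : ENNReal.ofReal x ≠ 0 := by simpa using hx
      have := h2.trans hx'
      rw [two_mul] at this
      have hkt : k t ≠ ∞ := by
        intro h; rw [h] at h2; simp at h2
      have hk0 : k t ≠ 0 := fun h => hx0 (by rw [h] at hx'; exact le_antisymm hx' zero_le)
      exact absurd this (not_le.2 (ENNReal.lt_add_right hkt hk0))
    · exact zero_le
    · exact le_rfl
  have h := lintegral_lintegral_level hp₀ hp₁ hη hp
    (measurable_levelSum (p₀ := p₀) (p₁ := p₁) (u₀ := u₀) (u₁ := u₁) (m := m) (a := a) |>.const_mul D⁻¹)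
  have h' := h.symm.trans_le (setLIntegral_mono' measurableSet_Ioi hpt)
  rw [lintegral_const_mul' _ _ (by finiteness)] at h'
  simp_rw [mul_left_comm _ D⁻¹] at h'
  rw [lintegral_const_mul' _ _ (ENNReal.inv_ne_top.2 hD0)] at h'
  have h'' := mul_le_mul_right h' (D * ENNReal.ofReal (p₀ * p₁))
  refine le_trans (le_of_eq ?_) (h''.trans (le_of_eq ?_))
  · rw [mul_assoc, ← mul_assoc (ENNReal.ofReal (p₀ * p₁)), ← ENNReal.ofReal_mul (by positivity),
      show p₀ * p₁ * (p₀⁻¹ * p₁⁻¹) = 1 by field_simp, ENNReal.ofReal_one, one_mul, ← mul_assoc,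
      ENNReal.mul_inv_cancel hD0 hDtop, one_mul]
  · ring

end LevelSum

/-! ### Whitney partitions -/

section Whitney

variable {n : ℕ} {Ω : Set (EuclideanSpace ℝ (Fin n))}

lemma bdryDist_pos (hΩ : IsOpen Ω) (hne : (frontier Ω).Nonempty) {y : EuclideanSpace ℝ (Fin n)}
    (hy : y ∈ Ω) : 0 < bdryDist Ω y := by
  refine (isClosed_frontier.notMem_iff_infDist_pos hne).1 fun h => ?_
  have : y ∈ Ω ∩ frontier Ω := ⟨hy, h⟩
  rw [hΩ.inter_frontier_eq] at this
  exact this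

lemma bdryDist_le_add (x y : EuclideanSpace ℝ (Fin n)) :
    bdryDist Ω x ≤ bdryDist Ω y + dist x y :=
  Metric.infDist_le_infDist_add_dist

/-- The ball is connected, meets Ω and misses the boundary, so it cannot leave Ω. -/
lemma ball_bdryDist_subset (hΩ : IsOpen Ω) {y : EuclideanSpace ℝ (Fin n)} (hy : y ∈ Ω) :
    Metric.ball y (bdryDist Ω y) ⊆ Ω := by
  rcases le_or_gt (bdryDist Ω y) 0 with h | h
  · rw [Metric.ball_eq_empty.2 h]; exact empty_subset _
  refine IsPreconnected.subset_left_of_subset_union hΩ isClosed_closure.isOpen_compl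
    (disjoint_compl_right_iff_subset.2 subset_closure) (fun z hz => ?_)
    ⟨y, Metric.mem_ball_self h, hy⟩ (convex_ball y _).isPreconnected
  by_contra hcon
  simp only [mem_union, mem_compl_iff, not_or, not_not] at hcon
  have hz' : z ∈ frontier Ω := by
    rw [hΩ.frontier_eq]; exact ⟨hcon.2, hcon.1⟩
  have := Metric.infDist_le_dist_of_mem (x := y) hz'
  rw [Metric.mem_ball, dist_comm] at hz
  exact absurd hz (not_lt.2 this)

variable (Ω) in
/-- A countable measurable partition of `Ω` into pieces of diameter at most comparable to `ε` times
the distance to the boundary, with centres that are separated at the same scale. -/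
structure WhitneyPartition (ε : ℝ) where
  /-- The index set. -/
  ι : Type
  countable : Countable ι
  /-- The centre of a piece. -/
  center : ι → EuclideanSpace ℝ (Fin n)
  /-- The pieces. -/
  piece : ι → Set (EuclideanSpace ℝ (Fin n))
  center_mem : ∀ i, center i ∈ Ω
  measurableSet_piece : ∀ i, MeasurableSet (piece i)
  pairwise_disjoint_piece : Pairwise fun i j => Disjoint (piece i) (piece j)
  piece_subset : ∀ i, piece i ⊆ Ω
  subset_iUnion_piece : Ω ⊆ ⋃ i, piece i
  dist_center_le : ∀ i, ∀ z ∈ piece i, dist z (center i) ≤ 3 * ε * bdryDist Ω (center i)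
  pairwise_disjoint_ball : Pairwise fun i j =>
    Disjoint (Metric.ball (center i) (ε * bdryDist Ω (center i)))
      (Metric.ball (center j) (ε * bdryDist Ω (center j)))

attribute [instance] WhitneyPartition.countable

/-- The centres form a maximal set with disjoint balls `B(x, ε δ(x))`. By maximality the larger
balls of radius `3 ε δ(x)` cover Ω, and they are made disjoint along an enumeration. -/
theorem exists_whitneyPartition (hΩ : IsOpen Ω) (hne : (frontier Ω).Nonempty) {ε : ℝ}
    (hε0 : 0 < ε) (hε : ε < 1 / 3) : Nonempty (WhitneyPartition Ω ε) := by
  obtain ⟨Z, hZ⟩ := zorn_subset {Z : Set (EuclideanSpace ℝ (Fin n)) | Z ⊆ Ω ∧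
      Z.PairwiseDisjoint fun x => Metric.ball x (ε * bdryDist Ω x)} (by
    intro c hc hchain
    refine ⟨⋃₀ c, ⟨sUnion_subset fun s hs => (hc hs).1,
      (pairwiseDisjoint_sUnion hchain.directedOn).2 fun s hs => (hc hs).2⟩,
      fun s hs => subset_sUnion_of_mem hs⟩)
  obtain ⟨hZΩ, hZd⟩ := hZ.prop
  have hcover : ∀ y ∈ Ω, ∃ x ∈ Z, dist y x ≤ 3 * ε * bdryDist Ω x := by
    intro y hy
    have hy0 := bdryDist_pos hΩ hne hy
    by_cases hyZ : y ∈ Z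
    · exact ⟨y, hyZ, by rw [dist_self]; positivity⟩
    have hnot : ¬ (∀ x ∈ Z, y ≠ x → Disjoint (Metric.ball y (ε * bdryDist Ω y))
        (Metric.ball x (ε * bdryDist Ω x))) := fun h =>
      hyZ (hZ.le_of_ge ⟨insert_subset hy hZΩ, hZd.insert h⟩ (subset_insert y Z) (mem_insert y Z))
    push Not at hnot
    obtain ⟨x, hx, -, hd⟩ := hnot
    obtain ⟨z, hzy, hzx⟩ := Set.not_disjoint_iff.1 hd
    rw [Metric.mem_ball] at hzy hzx
    have h1 := dist_triangle_left y x z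
    have h2 := bdryDist_le_add (Ω := Ω) y x
    have hx0 := bdryDist_pos hΩ hne (hZΩ hx)
    refine ⟨x, hx, ?_⟩
    -- From intersecting balls, `dist y x < ε (δ(y) + δ(x))` and `δ(y) ≤ δ(x) + dist y x`. Since `ε
    -- < 1 / 3`, dividing by `1 - ε` gives the radius `3 ε δ(x)`.
    have h3 : (1 - ε) * dist y x ≤ 2 * ε * bdryDist Ω x := by nlinarith
    have h4 : 2 / 3 * dist y x ≤ (1 - ε) * dist y x := by
      have := dist_nonneg (x := y) (y := x)
      nlinarith
    linarith
  have hZc : Z.Countable := hZd.countable_of_isOpen (fun _ _ => Metric.isOpen_ball) fun x hx =>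
    Metric.nonempty_ball.2 (mul_pos hε0 (bdryDist_pos hΩ hne (hZΩ hx)))
  have : Countable Z := hZc.to_subtype
  obtain ⟨e, he⟩ := exists_injective_nat Z
  set Q : Z → Set (EuclideanSpace ℝ (Fin n)) := fun x =>
    {y ∈ Ω | dist y x ≤ 3 * ε * bdryDist Ω x} with hQ
  have hQm : ∀ x, MeasurableSet (Q x) := fun x =>
    hΩ.measurableSet.inter (measurableSet_le (measurable_id.dist measurable_const) measurable_const)
  refine ⟨⟨Z, this, fun x => x, fun x => Q x \ ⋃ y ∈ {y : Z | e y < e x}, Q y, fun x => hZΩ x.2,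
    fun x => (hQm x).diff (MeasurableSet.biUnion (to_countable _) fun y _ => hQm y), ?_,
    fun x z hz => hz.1.1, ?_, fun x z hz => hz.1.2, hZd.subtype _ _⟩⟩
  · intro x y hxy
    rw [Set.disjoint_left]
    rintro z ⟨hzx, hzx'⟩ ⟨hzy, hzy'⟩
    simp only [mem_iUnion, mem_ofPred_eq, not_exists] at hzx' hzy'
    rcases lt_trichotomy (e x) (e y) with h | h | h
    · exact hzy' x h hzx
    · exact hxy (he h)
    · exact hzx' y h hzy
  · intro z hz
    have hex : ∃ k : ℕ, ∃ x : Z, e x = k ∧ z ∈ Q x := by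
      obtain ⟨x, hx, hd⟩ := hcover z hz
      exact ⟨_, ⟨x, hx⟩, rfl, hz, hd⟩
    classical
    obtain ⟨x, hxk, hzx⟩ := Nat.find_spec hex
    refine mem_iUnion.2 ⟨x, hzx, fun hcon => ?_⟩
    simp only [mem_iUnion, mem_ofPred_eq] at hcon
    obtain ⟨y, hyx, hzy⟩ := hcon
    exact Nat.find_min hex (hxk ▸ hyx) ⟨y, rfl, hzy⟩

end Whitney

/-! ### Comparison of powers and of norms -/

/-- Comparability in both directions is assumed because the exponent of the distance weight may have
either sign. -/
lemma rpow_le_mul_rpow_of_le_mul {D E K : ℝ≥0∞} (hK0 : K ≠ 0) (hK : K ≠ ∞) (h : D ≤ K * E)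
    (h' : E ≤ K * D) (e : ℝ) : D ^ e ≤ K ^ |e| * E ^ e := by
  rcases le_total 0 e with he | he
  · rw [abs_of_nonneg he, ← ENNReal.mul_rpow_of_nonneg _ _ he]
    gcongr
  · have he' : 0 ≤ -e := by linarith
    have key : D⁻¹ ≤ K * E⁻¹ := by
      have := ENNReal.inv_le_inv.2 h'
      rw [ENNReal.mul_inv (Or.inl hK0) (Or.inl hK)] at this
      have h2 := mul_le_mul_right this K
      rwa [← mul_assoc, ENNReal.mul_inv_cancel hK0 hK, one_mul] at h2
    rw [abs_of_nonpos he, show D ^ e = D⁻¹ ^ (-e) by rw [ENNReal.inv_rpow, ENNReal.rpow_neg, inv_inv],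
      show E ^ e = E⁻¹ ^ (-e) by rw [ENNReal.inv_rpow, ENNReal.rpow_neg, inv_inv],
      ← ENNReal.mul_rpow_of_nonneg _ _ he']
    gcongr

/-- For β = ∞ the exponent `(1 / β).toReal` is 0 and the factor is 1, so all β are treated at once.
-/
lemma eLpNorm_le_of_measure_le_smul {α F : Type*} [MeasurableSpace α] [NormedAddCommGroup F]
    {μ ν : Measure α} {K : ℝ≥0∞} (h : μ ≤ K • ν) (β : ℝ≥0∞) (f : α → F) :
    eLpNorm f β μ ≤ K ^ (1 / β).toReal * eLpNorm f β ν :=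
  (eLpNorm_mono_measure f h).trans (eLpNorm_smul_measure_le K f β ν)

lemma smul_measure_le_smul_measure {α : Type*} [MeasurableSpace α] {μ ν : Measure α} {a b : ℝ≥0∞}
    (hab : a ≤ b) (h : μ ≤ ν) : a • μ ≤ b • ν :=
  Measure.le_iff.2 fun A _ => by
    rw [Measure.smul_apply, Measure.smul_apply, smul_eq_mul, smul_eq_mul]
    exact mul_le_mul' hab (h A)

/-- Comparison with the largest term works for every p > 0, without convexity. -/
lemma finset_sum_rpow_le {ι : Type*} (F : Finset ι) {M : ℝ≥0∞} (hM : (F.card : ℝ≥0∞) ≤ M) {p : ℝ}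
    (hp : 0 < p) (a : ι → ℝ≥0∞) : (∑ i ∈ F, a i) ^ p ≤ M ^ p * ∑ i ∈ F, a i ^ p := by
  rcases F.eq_empty_or_nonempty with rfl | hF
  · simp [hp]
  obtain ⟨j, hj, hmax⟩ := F.exists_max_image a hF
  calc (∑ i ∈ F, a i) ^ p ≤ (F.card • a j) ^ p := by
        gcongr; exact Finset.sum_le_card_nsmul _ _ _ hmax
    _ ≤ (M * a j) ^ p := by rw [nsmul_eq_mul]; gcongr
    _ = M ^ p * a j ^ p := ENNReal.mul_rpow_of_nonneg _ _ hp.le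
    _ ≤ _ := by
        gcongr
        exact Finset.single_le_sum (f := fun i => a i ^ p) (fun _ _ => zero_le) hj

lemma volume_ball_eq {n : ℕ} (x : EuclideanSpace ℝ (Fin n)) {r : ℝ} (hr : 0 < r) :
    volume (Metric.ball x r) =
      ENNReal.ofReal r ^ n * volume (Metric.ball (0 : EuclideanSpace ℝ (Fin n)) 1) := by
  rw [Measure.addHaar_ball_of_pos _ _ hr, finrank_euclideanSpace_fin, ENNReal.ofReal_pow hr.le]

/-! ### Discretisation of the averaged norms -/

section Coefficients

variable {n : ℕ} {Ω : Set (EuclideanSpace ℝ (Fin n))} {ε : ℝ} {V : Type*} [NormedAddCommGroup V]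

namespace WhitneyPartition

/-- The distance of the centre of a piece to the boundary. -/
def scale (W : WhitneyPartition Ω ε) (i : W.ι) : ℝ≥0∞ := ENNReal.ofReal (bdryDist Ω (W.center i))

/-- The normalised `L^β` norm of `u` on a piece. -/
def coeff (W : WhitneyPartition Ω ε) (β : ℝ≥0∞) (u : EuclideanSpace ℝ (Fin n) → V) (i : W.ι) :
    ℝ≥0∞ :=
  eLpNorm u β ((W.scale i ^ n)⁻¹ • volume.restrict (W.piece i))

variable (W : WhitneyPartition Ω ε)

lemma scale_ne_top (i : W.ι) : W.scale i ≠ ∞ := ENNReal.ofReal_ne_top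

lemma scale_ne_zero (hΩ : IsOpen Ω) (hne : (frontier Ω).Nonempty) (i : W.ι) : W.scale i ≠ 0 := by
  simpa [scale] using bdryDist_pos hΩ hne (W.center_mem i)

/-- The piece lies within `4 ε δᵢ ≤ c δᵢ / 2` of y, while `c δ(y) ≥ 7 c δᵢ / 8`; hence it is
contained in the averaging ball, whose radius is at most `2 δᵢ`. -/
lemma coeff_le_whitneyAvg (hΩ : IsOpen Ω) (hne : (frontier Ω).Nonempty) {c : ℝ} (hc0 : 0 < c)
    (hc1 : c < 1) (hε : ε ≤ c / 8) (β : ℝ≥0∞) (u : EuclideanSpace ℝ (Fin n) → V)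
    (i : W.ι) {y : EuclideanSpace ℝ (Fin n)}
    (hy : y ∈ Metric.ball (W.center i) (ε * bdryDist Ω (W.center i))) :
    W.coeff β u i ≤ (2 ^ n * volume (Metric.ball (0 : EuclideanSpace ℝ (Fin n)) 1)) ^
      (1 / β).toReal * whitneyAvg Ω c β u y := by
  set v := volume (Metric.ball (0 : EuclideanSpace ℝ (Fin n)) 1) with hv
  have hv0 : v ≠ 0 := (Metric.measure_ball_pos _ _ one_pos).ne'
  have hvt : v ≠ ∞ := measure_ball_lt_top.ne
  have hx0 := bdryDist_pos hΩ hne (W.center_mem i)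
  rw [Metric.mem_ball] at hy
  have h1 := bdryDist_le_add (Ω := Ω) (W.center i) y
  have h2 := bdryDist_le_add (Ω := Ω) y (W.center i)
  rw [dist_comm] at h1
  have hε8 : ε * bdryDist Ω (W.center i) ≤ c / 8 * bdryDist Ω (W.center i) := by gcongr
  have hc8 : c / 8 * bdryDist Ω (W.center i) ≤ 1 / 8 * bdryDist Ω (W.center i) := by gcongr
  have hy0 : 0 < bdryDist Ω y := by linarith
  refine eLpNorm_le_of_measure_le_smul ?_ _ _
  have hsub : W.piece i ⊆ Metric.ball y (c * bdryDist Ω y) := by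
    intro z hz
    rw [Metric.mem_ball]
    have h3 := W.dist_center_le i z hz
    have h4 := dist_triangle_right z y (W.center i)
    have h5 : c * (7 / 8 * bdryDist Ω (W.center i)) ≤ c * bdryDist Ω y := by gcongr; linarith
    have : 0 < c * bdryDist Ω (W.center i) := by positivity
    linarith
  rw [smul_smul]
  refine smul_measure_le_smul_measure ?_ (Measure.restrict_mono hsub le_rfl)
  have hvol : volume (Metric.ball y (c * bdryDist Ω y)) ≤ W.scale i ^ n * (2 ^ n * v) := by
    rw [volume_ball_eq _ (by positivity), ← hv, ← mul_assoc, ← mul_pow, scale]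
    gcongr
    rw [mul_comm _ (2 : ℝ≥0∞), ← ENNReal.ofReal_ofNat, ← ENNReal.ofReal_mul (by norm_num)]
    refine ENNReal.ofReal_le_ofReal ?_
    have : c * bdryDist Ω y ≤ 1 * bdryDist Ω y := by gcongr
    linarith
  have h2v0 : 2 ^ n * v ≠ 0 := mul_ne_zero (pow_ne_zero _ two_ne_zero) hv0
  have h2vt : 2 ^ n * v ≠ ∞ := ENNReal.mul_ne_top (ENNReal.pow_ne_top ENNReal.ofNat_ne_top) hvt
  calc (W.scale i ^ n)⁻¹ = 2 ^ n * v * (W.scale i ^ n * (2 ^ n * v))⁻¹ := by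
        rw [ENNReal.mul_inv (Or.inr h2vt) (Or.inr h2v0), mul_left_comm,
          ENNReal.mul_inv_cancel h2v0 h2vt, mul_one]
    _ ≤ _ := by gcongr

/-- The volume factor `δ ^ n` cancels the `-n` in the weight and leaves `δ ^ d`, the same measure
for every p and s. -/
lemma scale_rpow_mul_pow (hΩ : IsOpen Ω) (hne : (frontier Ω).Nonempty) {p : ℝ} (hp : 0 < p)
    (d s : ℝ) (i : W.ι) (b : ℝ≥0∞) :
    (W.scale i ^ (1 - s) * b) ^ p * W.scale i ^ d =
      b ^ p * W.scale i ^ (d - n + p - p * s) * W.scale i ^ n := by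
  have h0 := W.scale_ne_zero hΩ hne i
  have ht := W.scale_ne_top i
  rw [ENNReal.mul_rpow_of_nonneg _ _ hp.le, ← ENNReal.rpow_mul, ← ENNReal.rpow_natCast, mul_assoc,
    mul_left_comm, mul_assoc, ← ENNReal.rpow_add _ _ h0 ht, ← ENNReal.rpow_add _ _ h0 ht]
  congr 2
  ring

/-- Each coefficient is dominated by the Whitney average at every point of the small ball about its
centre. Average over that ball; these balls are disjoint and lie in Ω, so the integrals add up. -/
theorem exists_tsum_coeff_le (hΩ : IsOpen Ω) (hne : (frontier Ω).Nonempty) {c : ℝ} (hc0 : 0 < c)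
    (hc1 : c < 1) (hε0 : 0 < ε) (hε : ε ≤ c / 8) (β : ℝ≥0∞) {p : ℝ} (hp : 0 < p) (d s : ℝ) :
    ∃ C : ℝ≥0∞, C ≠ ∞ ∧ ∀ u : EuclideanSpace ℝ (Fin n) → V,
      ∑' i, (W.scale i ^ (1 - s) * W.coeff β u i) ^ p * W.scale i ^ d ≤
        C * ∫⁻ y in Ω, whitneyAvg Ω c β u y ^ p *
          ENNReal.ofReal (bdryDist Ω y) ^ (d - (n : ℝ) + p - p * s) := by
  set v := volume (Metric.ball (0 : EuclideanSpace ℝ (Fin n)) 1) with hv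
  have hv0 : v ≠ 0 := (Metric.measure_ball_pos _ _ one_pos).ne'
  have hvt : v ≠ ∞ := measure_ball_lt_top.ne
  set e := d - (n : ℝ) + p - p * s with he
  set K : ℝ≥0∞ := (2 ^ n * v) ^ (1 / β).toReal with hK
  have hKt : K ≠ ∞ := ENNReal.rpow_ne_top_of_nonneg ENNReal.toReal_nonneg
    (ENNReal.mul_ne_top (ENNReal.pow_ne_top ENNReal.ofNat_ne_top) hvt)
  have hε' : ENNReal.ofReal ε ^ n * v ≠ 0 :=
    mul_ne_zero (pow_ne_zero _ (by simpa using hε0)) hv0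
  have hε'' : ENNReal.ofReal ε ^ n * v ≠ ∞ :=
    ENNReal.mul_ne_top (ENNReal.pow_ne_top ENNReal.ofReal_ne_top) hvt
  have hC1 : K ^ p * 2 ^ |e| ≠ ∞ := ENNReal.mul_ne_top (ENNReal.rpow_ne_top_of_nonneg hp.le hKt)
    (ENNReal.rpow_ne_top_of_nonneg (abs_nonneg _) ENNReal.ofNat_ne_top)
  refine ⟨(ENNReal.ofReal ε ^ n * v)⁻¹ * (K ^ p * 2 ^ |e|),
    ENNReal.mul_ne_top (ENNReal.inv_ne_top.2 hε') hC1, fun u => ?_⟩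
  set B : W.ι → Set (EuclideanSpace ℝ (Fin n)) :=
    fun i => Metric.ball (W.center i) (ε * bdryDist Ω (W.center i)) with hB
  set f : EuclideanSpace ℝ (Fin n) → ℝ≥0∞ := fun y => whitneyAvg Ω c β u y ^ p *
          ENNReal.ofReal (bdryDist Ω y) ^ e with hf
  have hterm : ∀ i, (W.scale i ^ (1 - s) * W.coeff β u i) ^ p * W.scale i ^ d ≤
      (ENNReal.ofReal ε ^ n * v)⁻¹ * (K ^ p * 2 ^ |e|) * ∫⁻ y in B i, f y := by
    intro i
    have hx0 := bdryDist_pos hΩ hne (W.center_mem i)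
    have hvol : W.scale i ^ n = (ENNReal.ofReal ε ^ n * v)⁻¹ * volume (B i) := by
      rw [hB]
      simp only
      rw [volume_ball_eq _ (by positivity), ← hv, ENNReal.ofReal_mul hε0.le, mul_pow,
        mul_right_comm, ← mul_assoc, ENNReal.inv_mul_cancel hε' hε'', one_mul, scale]
    rw [W.scale_rpow_mul_pow hΩ hne hp, ← he, hvol, mul_left_comm, mul_assoc _ (_ * _) (lintegral _ _)]
    refine mul_le_mul_right ?_ _
    rw [← setLIntegral_const, ← lintegral_const_mul' _ _ hC1]
    refine setLIntegral_mono' Metric.isOpen_ball.measurableSet fun y hy => ?_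
    rw [hf]
    simp only
    have h1 := bdryDist_le_add (Ω := Ω) (W.center i) y
    have h2 := bdryDist_le_add (Ω := Ω) y (W.center i)
    rw [dist_comm] at h1
    have hy' : dist y (W.center i) < ε * bdryDist Ω (W.center i) := hy
    have hε8 : ε * bdryDist Ω (W.center i) ≤ c / 8 * bdryDist Ω (W.center i) := by gcongr
    have hc8 : c / 8 * bdryDist Ω (W.center i) ≤ 1 / 8 * bdryDist Ω (W.center i) := by gcongr
    have e1 : W.scale i ^ e ≤ 2 ^ |e| * ENNReal.ofReal (bdryDist Ω y) ^ e := by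
      refine rpow_le_mul_rpow_of_le_mul two_ne_zero ENNReal.ofNat_ne_top ?_ ?_ e
      · rw [scale, ← ENNReal.ofReal_ofNat, ← ENNReal.ofReal_mul (by norm_num)]
        exact ENNReal.ofReal_le_ofReal (by linarith)
      · rw [scale, ← ENNReal.ofReal_ofNat, ← ENNReal.ofReal_mul (by norm_num)]
        exact ENNReal.ofReal_le_ofReal (by linarith)
    have e2 : W.coeff β u i ^ p ≤ K ^ p * whitneyAvg Ω c β u y ^ p := by
      rw [← ENNReal.mul_rpow_of_nonneg _ _ hp.le]
      gcongr
      exact W.coeff_le_whitneyAvg hΩ hne hc0 hc1 hε β u i hy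
    rw [mul_mul_mul_comm]
    gcongr
  refine (ENNReal.tsum_le_tsum hterm).trans ?_
  rw [ENNReal.tsum_mul_left]
  gcongr
  rw [← lintegral_iUnion (fun i => Metric.isOpen_ball.measurableSet) W.pairwise_disjoint_ball]
  refine lintegral_mono_set (iUnion_subset fun i => ?_)
  refine (Metric.ball_subset_ball ?_).trans (ball_bdryDist_subset hΩ (W.center_mem i))
  have hx0 := bdryDist_pos hΩ hne (W.center_mem i)
  have : ε * bdryDist Ω (W.center i) ≤ 1 * bdryDist Ω (W.center i) := by gcongr; linarith
  linarith

/-- The pieces that meet the ball `B(y, c δ(y))`. -/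
def near (c : ℝ) (y : EuclideanSpace ℝ (Fin n)) : Set W.ι :=
  {i | (W.piece i ∩ Metric.ball y (c * bdryDist Ω y)).Nonempty}

lemma near_estimates {c : ℝ} (hc1 : c < 1) (hε : ε ≤ c / 8)
    {y : EuclideanSpace ℝ (Fin n)} {i : W.ι} (hi : i ∈ W.near c y) (hy : 0 < bdryDist Ω y)
    (hx : 0 < bdryDist Ω (W.center i)) :
    bdryDist Ω (W.center i) ≤ 4 * bdryDist Ω y ∧
      bdryDist Ω y ≤ 2 / (1 - c) * bdryDist Ω (W.center i) ∧
      dist y (W.center i) ≤ 3 * bdryDist Ω y := by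
  obtain ⟨z, hz, hzy⟩ := hi
  rw [Metric.mem_ball] at hzy
  have h0 := W.dist_center_le i z hz
  have h1 := bdryDist_le_add (Ω := Ω) (W.center i) z
  have h2 := bdryDist_le_add (Ω := Ω) z y
  have h3 := bdryDist_le_add (Ω := Ω) y z
  have h4 := bdryDist_le_add (Ω := Ω) z (W.center i)
  have h5 := dist_triangle_left y (W.center i) z
  rw [dist_comm (W.center i) z] at h1
  rw [dist_comm y z] at h3
  have hε8 : ε * bdryDist Ω (W.center i) ≤ c / 8 * bdryDist Ω (W.center i) := by gcongr
  have hc8 : c / 8 * bdryDist Ω (W.center i) ≤ 1 / 8 * bdryDist Ω (W.center i) := by gcongr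
  have hcy : c * bdryDist Ω y ≤ 1 * bdryDist Ω y := by gcongr
  have h6 : bdryDist Ω (W.center i) ≤ 4 * bdryDist Ω y := by linarith
  refine ⟨h6, ?_, by linarith⟩
  rw [div_mul_eq_mul_div, le_div_iff₀ (by linarith)]
  linarith

/-- Packing by volume: the disjoint balls about these centres have radius at least `ε (1 - c) δ(y) /
2` and lie in `B(y, 4 δ(y))`. -/
lemma card_near_le (hΩ : IsOpen Ω) (hne : (frontier Ω).Nonempty) {c : ℝ} (hc0 : 0 < c)
    (hc1 : c < 1) (hε0 : 0 < ε) (hε : ε ≤ c / 8) {y : EuclideanSpace ℝ (Fin n)} (hy : y ∈ Ω)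
    (F : Finset W.ι) (hF : ∀ i ∈ F, i ∈ W.near c y) :
    (F.card : ℝ≥0∞) ≤ ENNReal.ofReal (8 / (ε * (1 - c))) ^ n := by
  set v := volume (Metric.ball (0 : EuclideanSpace ℝ (Fin n)) 1) with hv
  have hv0 : v ≠ 0 := (Metric.measure_ball_pos _ _ one_pos).ne'
  have hvt : v ≠ ∞ := measure_ball_lt_top.ne
  have hy0 := bdryDist_pos hΩ hne hy
  have h1c : 0 < 1 - c := by linarith
  have hr : 0 < ε * (1 - c) / 2 * bdryDist Ω y := by positivity
  have h1 : ∑ i ∈ F, volume (Metric.ball (W.center i) (ε * bdryDist Ω (W.center i))) ≤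
      volume (Metric.ball y (4 * bdryDist Ω y)) := by
    rw [← measure_biUnion_finset (fun i _ j _ hij => W.pairwise_disjoint_ball hij)
      (fun i _ => Metric.isOpen_ball.measurableSet)]
    refine measure_mono (iUnion₂_subset fun i hi => Metric.ball_subset_ball' ?_)
    have hx0 := bdryDist_pos hΩ hne (W.center_mem i)
    obtain ⟨h1, -, h3⟩ := W.near_estimates hc1 hε (hF i hi) hy0 hx0
    rw [dist_comm]
    have hε8 : ε * bdryDist Ω (W.center i) ≤ 1 / 8 * bdryDist Ω (W.center i) := by
      gcongr; linarith
    linarith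
  have h2 : F.card • (ENNReal.ofReal (ε * (1 - c) / 2 * bdryDist Ω y) ^ n * v) ≤
      ∑ i ∈ F, volume (Metric.ball (W.center i) (ε * bdryDist Ω (W.center i))) := by
    refine Finset.card_nsmul_le_sum _ _ _ fun i hi => ?_
    have hx0 := bdryDist_pos hΩ hne (W.center_mem i)
    obtain ⟨-, h2, -⟩ := W.near_estimates hc1 hε (hF i hi) hy0 hx0
    rw [volume_ball_eq _ (by positivity)]
    refine mul_le_mul_left (pow_le_pow_left' (ENNReal.ofReal_le_ofReal ?_) n) v
    rw [div_mul_eq_mul_div, le_div_iff₀ h1c] at h2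
    nlinarith
  have h3 := h2.trans h1
  rw [volume_ball_eq _ (by positivity), nsmul_eq_mul, ← hv, ← mul_assoc] at h3
  have h4 := (ENNReal.mul_le_mul_iff_left hv0 hvt).1 h3
  have h5 : ENNReal.ofReal (4 * bdryDist Ω y) ^ n = ENNReal.ofReal (8 / (ε * (1 - c))) ^ n *
      ENNReal.ofReal (ε * (1 - c) / 2 * bdryDist Ω y) ^ n := by
    rw [← mul_pow, ← ENNReal.ofReal_mul (by positivity)]
    congr 2
    field_simp
    ring
  rw [h5] at h4
  exact (ENNReal.mul_le_mul_iff_left (pow_ne_zero _ (by simpa using hr))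
    (ENNReal.pow_ne_top ENNReal.ofReal_ne_top)).1 h4

lemma finite_near (hΩ : IsOpen Ω) (hne : (frontier Ω).Nonempty) {c : ℝ} (hc0 : 0 < c)
    (hc1 : c < 1) (hε0 : 0 < ε) (hε : ε ≤ c / 8) {y : EuclideanSpace ℝ (Fin n)} (hy : y ∈ Ω) :
    (W.near c y).Finite := by
  by_contra hinf
  obtain ⟨N, hN⟩ := ENNReal.exists_nat_gt
    (ENNReal.pow_ne_top (n := n) (ENNReal.ofReal_ne_top (r := 8 / (ε * (1 - c)))))
  obtain ⟨F, hF, rfl⟩ := Set.Infinite.exists_subset_card_eq hinf N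
  exact absurd (W.card_near_le hΩ hne hc0 hc1 hε0 hε hy F fun i hi => hF hi) (not_le.2 hN)

/-- On the averaging ball u is the sum of its restrictions to the nearby pieces; Minkowski's
inequality, which needs β ≥ 1, gives the bound. -/
lemma whitneyAvg_le_sum_coeff (hΩ : IsOpen Ω) (hne : (frontier Ω).Nonempty) {c : ℝ} (hc0 : 0 < c)
    (hc1 : c < 1) (hε : ε ≤ c / 8) {β : ℝ≥0∞} (hβ : 1 ≤ β)
    {u : EuclideanSpace ℝ (Fin n) → V} (hu : AEStronglyMeasurable u (volume.restrict Ω))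
    {y : EuclideanSpace ℝ (Fin n)} (hy : y ∈ Ω) {F : Finset W.ι} (hF : ∀ i, i ∈ F ↔ i ∈ W.near c y) :
    whitneyAvg Ω c β u y ≤ (ENNReal.ofReal (4 / c) ^ n *
      (volume (Metric.ball (0 : EuclideanSpace ℝ (Fin n)) 1))⁻¹) ^ (1 / β).toReal *
        ∑ i ∈ F, W.coeff β u i := by
  set v := volume (Metric.ball (0 : EuclideanSpace ℝ (Fin n)) 1) with hv
  have hv0 : v ≠ 0 := (Metric.measure_ball_pos _ _ one_pos).ne'
  have hvt : v ≠ ∞ := measure_ball_lt_top.ne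
  have hy0 := bdryDist_pos hΩ hne hy
  set B := Metric.ball y (c * bdryDist Ω y) with hB
  have hBΩ : B ⊆ Ω := (Metric.ball_subset_ball (by nlinarith)).trans (ball_bdryDist_subset hΩ hy)
  have hcongr : eLpNorm u β ((volume B)⁻¹ • volume.restrict B) =
      eLpNorm (∑ i ∈ F, (W.piece i).indicator u) β ((volume B)⁻¹ • volume.restrict B) := by
    refine eLpNorm_congr_ae (Measure.ae_smul_measure ?_ _)
    filter_upwards [ae_restrict_mem (Metric.isOpen_ball.measurableSet)] with z hz
    obtain ⟨i, hi⟩ := mem_iUnion.1 (W.subset_iUnion_piece (hBΩ hz))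
    rw [Finset.sum_apply, Finset.sum_eq_single i, indicator_of_mem hi]
    · intro j _ hji
      exact indicator_of_notMem (fun hj => Set.disjoint_left.1 (W.pairwise_disjoint_piece hji) hj hi) _
    · intro h
      exact absurd ((hF i).2 ⟨z, hi, hz⟩) h
  have hmeas : AEStronglyMeasurable u ((volume B)⁻¹ • volume.restrict B) :=
    (hu.mono_measure (Measure.restrict_mono hBΩ le_rfl)).smul_measure _
  change eLpNorm u β ((volume B)⁻¹ • volume.restrict B) ≤ _
  rw [hcongr, Finset.mul_sum]
  refine (eLpNorm_sum_le (fun i _ => hmeas.indicator (W.measurableSet_piece i)) hβ).trans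
    (Finset.sum_le_sum fun i hi => ?_)
  rw [eLpNorm_indicator_eq_eLpNorm_restrict (W.measurableSet_piece i)]
  refine eLpNorm_le_of_measure_le_smul ?_ _ _
  have hx0 := bdryDist_pos hΩ hne (W.center_mem i)
  obtain ⟨h1, -, -⟩ := W.near_estimates hc1 hε ((hF i).1 hi) hy0 hx0
  rw [Measure.restrict_smul, smul_smul]
  refine smul_measure_le_smul_measure ?_ (Measure.restrict_mono_measure Measure.restrict_le_self _)
  have hvol : W.scale i ^ n * v * (ENNReal.ofReal (4 / c) ^ n)⁻¹ ≤ volume B := by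
    rw [hB, volume_ball_eq _ (by positivity), ← hv]
    refine ENNReal.div_le_of_le_mul ?_
    rw [mul_right_comm, ← mul_pow, ← ENNReal.ofReal_mul (by positivity), scale]
    gcongr
    rw [show c * bdryDist Ω y * (4 / c) = 4 * bdryDist Ω y by field_simp]
    exact h1
  have h4c : ENNReal.ofReal (4 / c) ^ n ≠ ∞ := ENNReal.pow_ne_top ENNReal.ofReal_ne_top
  have h4c0 : ENNReal.ofReal (4 / c) ^ n ≠ 0 :=
    pow_ne_zero _ (by simpa using (show 0 < 4 / c by positivity))
  refine (ENNReal.inv_le_inv.2 hvol).trans (le_of_eq ?_)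
  rw [ENNReal.mul_inv (Or.inr (ENNReal.inv_ne_top.2 h4c0)) (Or.inr (ENNReal.inv_ne_zero.2 h4c)),
    inv_inv, ENNReal.mul_inv (Or.inr hvt) (Or.inr hv0)]
  ring

theorem exists_lintegral_whitneyAvg_le (hΩ : IsOpen Ω) (hne : (frontier Ω).Nonempty) {c : ℝ}
    (hc0 : 0 < c) (hc1 : c < 1) (hε0 : 0 < ε) (hε : ε ≤ c / 8) {β : ℝ≥0∞} (hβ : 1 ≤ β) {p : ℝ}
    (hp : 0 < p) (d s : ℝ) :
    ∃ C : ℝ≥0∞, C ≠ ∞ ∧ ∀ u : EuclideanSpace ℝ (Fin n) → V,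
      AEStronglyMeasurable u (volume.restrict Ω) →
      ∫⁻ y in Ω, whitneyAvg Ω c β u y ^ p *
          ENNReal.ofReal (bdryDist Ω y) ^ (d - (n : ℝ) + p - p * s) ≤
        C * ∑' i, (W.scale i ^ (1 - s) * W.coeff β u i) ^ p * W.scale i ^ d := by
  set v := volume (Metric.ball (0 : EuclideanSpace ℝ (Fin n)) 1) with hv
  have hv0 : v ≠ 0 := (Metric.measure_ball_pos _ _ one_pos).ne'
  have hvt : v ≠ ∞ := measure_ball_lt_top.ne
  have h1c : 0 < 1 - c := by linarith
  set e := d - (n : ℝ) + p - p * s with he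
  set K : ℝ≥0∞ := (ENNReal.ofReal (4 / c) ^ n * v⁻¹) ^ (1 / β).toReal with hK
  have hKt : K ≠ ∞ := ENNReal.rpow_ne_top_of_nonneg ENNReal.toReal_nonneg
    (ENNReal.mul_ne_top (ENNReal.pow_ne_top ENNReal.ofReal_ne_top) (ENNReal.inv_ne_top.2 hv0))
  set M : ℝ≥0∞ := ENNReal.ofReal (8 / (ε * (1 - c))) ^ n with hM
  have hMt : M ≠ ∞ := ENNReal.pow_ne_top ENNReal.ofReal_ne_top
  set L : ℝ := max 4 (2 / (1 - c)) with hL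
  have hL0 : 0 < L := lt_of_lt_of_le (by norm_num) (le_max_left _ _)
  have hC1 : K ^ p * M ^ p * ENNReal.ofReal L ^ |e| ≠ ∞ := ENNReal.mul_ne_top (ENNReal.mul_ne_top
    (ENNReal.rpow_ne_top_of_nonneg hp.le hKt) (ENNReal.rpow_ne_top_of_nonneg hp.le hMt))
    (ENNReal.rpow_ne_top_of_nonneg (abs_nonneg _) ENNReal.ofReal_ne_top)
  refine ⟨K ^ p * M ^ p * ENNReal.ofReal L ^ |e| * (ENNReal.ofReal (4 * L) ^ n * v),
    ENNReal.mul_ne_top hC1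
      (ENNReal.mul_ne_top (ENNReal.pow_ne_top ENNReal.ofReal_ne_top) hvt), fun u hu => ?_⟩
  -- If piece i is near y then `dist y xᵢ ≤ 3 δ(y) ≤ 3 L δᵢ`, so y lies in `T i`. Only the volume of
  -- each `T i` matters below, not how these balls overlap or whether they stay inside Ω.
  set T : W.ι → Set (EuclideanSpace ℝ (Fin n)) :=
    fun i => Metric.ball (W.center i) (4 * L * bdryDist Ω (W.center i)) with hT
  have hpt : ∀ y ∈ Ω, whitneyAvg Ω c β u y ^ p * ENNReal.ofReal (bdryDist Ω y) ^ e ≤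
      K ^ p * M ^ p * ENNReal.ofReal L ^ |e| *
        ∑' i, (T i).indicator (fun _ => W.coeff β u i ^ p * W.scale i ^ e) y := by
    intro y hy
    have hy0 := bdryDist_pos hΩ hne hy
    have hfin := W.finite_near hΩ hne hc0 hc1 hε0 hε hy
    have hF : ∀ i, i ∈ hfin.toFinset ↔ i ∈ W.near c y := fun i => hfin.mem_toFinset
    set F := hfin.toFinset
    have h1 : whitneyAvg Ω c β u y ^ p ≤ K ^ p * (M ^ p * ∑ i ∈ F, W.coeff β u i ^ p) := by
      refine (ENNReal.rpow_le_rpow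
        (W.whitneyAvg_le_sum_coeff hΩ hne hc0 hc1 hε hβ hu hy hF) hp.le).trans ?_
      rw [ENNReal.mul_rpow_of_nonneg _ _ hp.le]
      gcongr
      exact finset_sum_rpow_le F
        (W.card_near_le hΩ hne hc0 hc1 hε0 hε hy F fun i hi => (hF i).1 hi) hp _
    have h2 : ∀ i ∈ F, W.coeff β u i ^ p * ENNReal.ofReal (bdryDist Ω y) ^ e ≤
        ENNReal.ofReal L ^ |e| *
          (T i).indicator (fun _ => W.coeff β u i ^ p * W.scale i ^ e) y := by
      intro i hi
      have hx0 := bdryDist_pos hΩ hne (W.center_mem i)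
      obtain ⟨e1, e2, e3⟩ := W.near_estimates hc1 hε ((hF i).1 hi) hy0 hx0
      have e4 : bdryDist Ω y ≤ L * bdryDist Ω (W.center i) :=
        e2.trans (mul_le_mul_of_nonneg_right (le_max_right _ _) hx0.le)
      have e5 : bdryDist Ω (W.center i) ≤ L * bdryDist Ω y :=
        e1.trans (mul_le_mul_of_nonneg_right (le_max_left _ _) hy0.le)
      rw [indicator_of_mem (show y ∈ T i by rw [hT, Metric.mem_ball]; linarith), mul_left_comm]
      gcongr
      refine rpow_le_mul_rpow_of_le_mul (by simpa using hL0) ENNReal.ofReal_ne_top ?_ ?_ e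
      · rw [scale, ← ENNReal.ofReal_mul hL0.le]; exact ENNReal.ofReal_le_ofReal e4
      · rw [scale, ← ENNReal.ofReal_mul hL0.le]; exact ENNReal.ofReal_le_ofReal e5
    calc whitneyAvg Ω c β u y ^ p * ENNReal.ofReal (bdryDist Ω y) ^ e
        ≤ K ^ p * (M ^ p * ∑ i ∈ F, W.coeff β u i ^ p) * ENNReal.ofReal (bdryDist Ω y) ^ e := by
          gcongr
      _ = K ^ p * M ^ p * ∑ i ∈ F, W.coeff β u i ^ p * ENNReal.ofReal (bdryDist Ω y) ^ e := by
          rw [← Finset.sum_mul]; ring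
      _ ≤ K ^ p * M ^ p * ∑ i ∈ F, ENNReal.ofReal L ^ |e| *
          (T i).indicator (fun _ => W.coeff β u i ^ p * W.scale i ^ e) y := by
          exact mul_le_mul_right (Finset.sum_le_sum h2) _
      _ ≤ _ := by
          rw [← Finset.mul_sum, ← mul_assoc]
          gcongr
          exact ENNReal.sum_le_tsum F
  refine (setLIntegral_mono' hΩ.measurableSet hpt).trans ?_
  rw [lintegral_const_mul' _ _ hC1, lintegral_tsum fun i =>
    (measurable_const.indicator Metric.isOpen_ball.measurableSet).aemeasurable,
    mul_assoc _ (ENNReal.ofReal (4 * L) ^ n * v)]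
  refine mul_le_mul_right ?_ _
  rw [← ENNReal.tsum_mul_left]
  refine ENNReal.tsum_le_tsum fun i => ?_
  have hx0 := bdryDist_pos hΩ hne (W.center_mem i)
  rw [lintegral_indicator_const Metric.isOpen_ball.measurableSet, W.scale_rpow_mul_pow hΩ hne hp,
    ← he, mul_left_comm]
  gcongr
  refine (Measure.restrict_apply_le _ _).trans (le_of_eq ?_)
  rw [volume_ball_eq _ (by positivity), ← hv, ENNReal.ofReal_mul (by positivity), mul_pow, scale]
  ring

end WhitneyPartition

end Coefficients

/-! ### Cutting functions along pieces, and the two inclusions between the spaces. -/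

section Interpolation

variable {n : ℕ} {Ω : Set (EuclideanSpace ℝ (Fin n))} {ε : ℝ} {V : Type*} [NormedAddCommGroup V]

namespace WhitneyPartition

variable (W : WhitneyPartition Ω ε)

lemma coeff_congr (β : ℝ≥0∞) {u w : EuclideanSpace ℝ (Fin n) → V}
    (h : u =ᵐ[volume.restrict Ω] w) (i : W.ι) : W.coeff β u i = W.coeff β w i :=
  eLpNorm_congr_ae (Measure.ae_smul_measure
    (ae_mono (Measure.restrict_mono (W.piece_subset i) le_rfl) h) _)

lemma coeff_add_le {β : ℝ≥0∞} (hβ : 1 ≤ β) (f g : EuclideanSpace ℝ (Fin n) →ₘ[volume.restrict Ω] V)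
    (i : W.ι) : W.coeff β (f + g : EuclideanSpace ℝ (Fin n) →ₘ[volume.restrict Ω] V) i ≤
      W.coeff β f i + W.coeff β g i := by
  rw [W.coeff_congr β (AEEqFun.coeFn_add f g)]
  exact eLpNorm_add_le f.stronglyMeasurable.aestronglyMeasurable
    g.stronglyMeasurable.aestronglyMeasurable hβ

/-- Local integrability enters here: the piece lies in a closed ball that is a compact subset of Ω
because `3 ε < 1`. -/
lemma coeff_ne_top (hΩ : IsOpen Ω) (hne : (frontier Ω).Nonempty) (hε : 3 * ε < 1) {β : ℝ≥0∞}
    {u : EuclideanSpace ℝ (Fin n) → V} (hu : MemLpLoc Ω β u) (i : W.ι) : W.coeff β u i ≠ ∞ := by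
  have hx0 := bdryDist_pos hΩ hne (W.center_mem i)
  have hK : Metric.closedBall (W.center i) (3 * ε * bdryDist Ω (W.center i)) ⊆ Ω :=
    (Metric.closedBall_subset_ball (by nlinarith)).trans (ball_bdryDist_subset hΩ (W.center_mem i))
  have h := hu _ (isCompact_closedBall _ _) hK
  have hle := (eLpNorm_smul_measure_le (W.scale i ^ n)⁻¹ u β (volume.restrict (W.piece i))).trans
    (mul_le_mul_right (eLpNorm_mono_measure u (Measure.restrict_mono (ν := volume)
      (fun z hz => Metric.mem_closedBall.2 (W.dist_center_le i z hz)) le_rfl)) _)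
  refine ne_top_of_le_ne_top (ENNReal.mul_ne_top ?_ h.eLpNorm_lt_top.ne) hle
  exact ENNReal.rpow_ne_top_of_nonneg ENNReal.toReal_nonneg
    (ENNReal.inv_ne_top.2 (pow_ne_zero _ (W.scale_ne_zero hΩ hne i)))

lemma measurableSet_biUnion_piece (I : Set W.ι) : MeasurableSet (⋃ i ∈ I, W.piece i) :=
  MeasurableSet.biUnion (to_countable _) fun i _ => W.measurableSet_piece i

/-- The restriction of `f` to a union of pieces. -/
def cut (f : EuclideanSpace ℝ (Fin n) →ₘ[volume.restrict Ω] V) (I : Set W.ι) :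
    EuclideanSpace ℝ (Fin n) →ₘ[volume.restrict Ω] V :=
  AEEqFun.mk ((⋃ i ∈ I, W.piece i).indicator f)
    (f.aestronglyMeasurable.indicator (W.measurableSet_biUnion_piece I))

lemma coeFn_cut (f : EuclideanSpace ℝ (Fin n) →ₘ[volume.restrict Ω] V) (I : Set W.ι) :
    W.cut f I =ᵐ[volume.restrict Ω] (⋃ i ∈ I, W.piece i).indicator f :=
  AEEqFun.coeFn_mk _ _

lemma mem_biUnion_piece_iff {I : Set W.ι} {i : W.ι} {z : EuclideanSpace ℝ (Fin n)}
    (hz : z ∈ W.piece i) : z ∈ ⋃ j ∈ I, W.piece j ↔ i ∈ I := by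
  simp only [mem_iUnion, exists_prop]
  constructor
  · rintro ⟨j, hj, hzj⟩
    by_cases hij : i = j
    · rwa [hij]
    · exact absurd hzj (Set.disjoint_left.1 (W.pairwise_disjoint_piece hij) hz)
  · exact fun hi => ⟨i, hi, hz⟩

lemma cut_add_cut_compl (hΩ : IsOpen Ω) (f : EuclideanSpace ℝ (Fin n) →ₘ[volume.restrict Ω] V)
    (I : Set W.ι) : W.cut f I + W.cut f Iᶜ = f := by
  refine AEEqFun.ext ?_
  filter_upwards [AEEqFun.coeFn_add (W.cut f I) (W.cut f Iᶜ), W.coeFn_cut f I, W.coeFn_cut f Iᶜ,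
    ae_restrict_mem hΩ.measurableSet] with z h1 h2 h3 hz
  obtain ⟨i, hi⟩ := mem_iUnion.1 (W.subset_iUnion_piece hz)
  rw [h1, Pi.add_apply, h2, h3]
  by_cases hI : i ∈ I
  · rw [indicator_of_mem ((W.mem_biUnion_piece_iff hi).2 hI),
      indicator_of_notMem (fun h => absurd hI ((W.mem_biUnion_piece_iff hi).1 h)), add_zero]
  · rw [indicator_of_notMem (fun h => hI ((W.mem_biUnion_piece_iff hi).1 h)),
      indicator_of_mem ((W.mem_biUnion_piece_iff hi).2 hI), zero_add]

/-- Disjointness of the pieces makes cutting act on coefficients exactly as an indicator, so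
splittings of the index set lift to functions. -/
lemma coeff_cut (β : ℝ≥0∞) (f : EuclideanSpace ℝ (Fin n) →ₘ[volume.restrict Ω] V) (I : Set W.ι)
    (i : W.ι) : W.coeff β (W.cut f I) i = I.indicator (W.coeff β f) i := by
  rw [W.coeff_congr β (W.coeFn_cut f I)]
  by_cases hI : i ∈ I
  · rw [indicator_of_mem hI]
    refine eLpNorm_congr_ae (Measure.ae_smul_measure ?_ _)
    filter_upwards [ae_restrict_mem (W.measurableSet_piece i)] with z hz
    rw [indicator_of_mem ((W.mem_biUnion_piece_iff hz).2 hI)]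
  · rw [indicator_of_notMem hI, coeff, ← eLpNorm_zero (p := β)
      (μ := (W.scale i ^ n)⁻¹ • volume.restrict (W.piece i)) (ε := V)]
    refine eLpNorm_congr_ae (Measure.ae_smul_measure ?_ _)
    filter_upwards [ae_restrict_mem (W.measurableSet_piece i)] with z hz
    rw [indicator_of_notMem (fun h => hI ((W.mem_biUnion_piece_iff hz).1 h)), Pi.zero_apply]

lemma memLpLoc_cut {β : ℝ≥0∞} {f : EuclideanSpace ℝ (Fin n) →ₘ[volume.restrict Ω] V}
    (hf : MemLpLoc Ω β f) (I : Set W.ι) : MemLpLoc Ω β (W.cut f I) := fun K hK hKΩ =>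
  ((hf K hK hKΩ).indicator (W.measurableSet_biUnion_piece I)).ae_eq
    (Filter.EventuallyEq.symm (ae_mono (Measure.restrict_mono hKΩ le_rfl) (W.coeFn_cut f I)))

/-- The `p`-th power of the discrete quasi-norm. -/
def seqNorm (d p : ℝ) (β : ℝ≥0∞) (s : ℝ) (u : EuclideanSpace ℝ (Fin n) → V) : ℝ≥0∞ :=
  ∑' i, (W.scale i ^ (1 - s) * W.coeff β u i) ^ p * W.scale i ^ d

lemma seqNorm_cut {d p : ℝ} (hp : 0 < p) (β : ℝ≥0∞) (s : ℝ)
    (f : EuclideanSpace ℝ (Fin n) →ₘ[volume.restrict Ω] V) (I : Set W.ι) :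
    W.seqNorm d p β s (W.cut f I) = ∑' i, I.indicator
      (fun i => (W.scale i ^ (1 - s) * W.coeff β f i) ^ p * W.scale i ^ d) i := by
  refine tsum_congr fun i => ?_
  rw [W.coeff_cut]
  by_cases hI : i ∈ I
  · rw [indicator_of_mem hI, indicator_of_mem hI]
  · rw [indicator_of_notMem hI, indicator_of_notMem hI, mul_zero, ENNReal.zero_rpow_of_pos hp,
      zero_mul]

theorem exists_seqNorm_le (hΩ : IsOpen Ω) (hne : (frontier Ω).Nonempty) {c : ℝ} (hc0 : 0 < c)
    (hc1 : c < 1) (hε0 : 0 < ε) (hε : ε ≤ c / 8) (β : ℝ≥0∞) {p : ℝ} (hp : 0 < p) (d s : ℝ) :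
    ∃ C : ℝ≥0∞, C ≠ ∞ ∧ ∀ f : EuclideanSpace ℝ (Fin n) →ₘ[volume.restrict Ω] V,
      W.seqNorm d p β s f ≤ (C * avNorm Ω d p c β s f) ^ p := by
  obtain ⟨C, hC, h⟩ := W.exists_tsum_coeff_le (V := V) hΩ hne hc0 hc1 hε0 hε β hp d s
  refine ⟨C ^ (1 / p), ENNReal.rpow_ne_top_of_nonneg (by positivity) hC, fun f => (h f).trans ?_⟩
  rw [avNorm, ENNReal.mul_rpow_of_nonneg _ _ hp.le, one_div, ENNReal.rpow_inv_rpow hp.ne',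
    ENNReal.rpow_inv_rpow hp.ne']

theorem exists_avNorm_le (hΩ : IsOpen Ω) (hne : (frontier Ω).Nonempty) {c : ℝ} (hc0 : 0 < c)
    (hc1 : c < 1) (hε0 : 0 < ε) (hε : ε ≤ c / 8) {β : ℝ≥0∞} (hβ : 1 ≤ β) {p : ℝ} (hp : 0 < p)
    (d s : ℝ) :
    ∃ C : ℝ≥0∞, C ≠ ∞ ∧ ∀ f : EuclideanSpace ℝ (Fin n) →ₘ[volume.restrict Ω] V,
      avNorm Ω d p c β s f ≤ C * W.seqNorm d p β s f ^ (1 / p) := by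
  obtain ⟨C, hC, h⟩ := W.exists_lintegral_whitneyAvg_le (V := V) hΩ hne hc0 hc1 hε0 hε hβ hp d s
  have hp' : 0 ≤ 1 / p := by positivity
  refine ⟨C ^ (1 / p), ENNReal.rpow_ne_top_of_nonneg hp' hC, fun f => ?_⟩
  rw [avNorm, ← ENNReal.mul_rpow_of_nonneg _ _ hp']
  exact ENNReal.rpow_le_rpow (h f f.aestronglyMeasurable) hp'

variable {p₀ p₁ p s₀ s₁ s γ η d c : ℝ} {β : ℝ≥0∞}

lemma lintegral_levelSum_coeff (hΩ : IsOpen Ω) (hne : (frontier Ω).Nonempty) (hε : 3 * ε < 1)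
    (hp₀ : 0 < p₀) (hp₁ : 0 < p₁) (hp : 0 < p) (hη0 : 0 < η) (hη1 : η < 1)
    (h0 : p₀ * (1 - η) = (1 - γ) * p) (h1 : p₁ * η = γ * p) (hs : s = (1 - γ) * s₀ + γ * s₁)
    {u : EuclideanSpace ℝ (Fin n) → V} (hu : MemLpLoc Ω β u) :
    ∫⁻ t in Ioi (0 : ℝ), ENNReal.ofReal (t ^ (-η - 1)) *
      levelSum p₀ p₁ (fun i => W.scale i ^ (1 - s₀)) (fun i => W.scale i ^ (1 - s₁))
        (fun i => W.scale i ^ d) (W.coeff β u) t =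
      ENNReal.ofReal (η⁻¹ + (1 - η)⁻¹) * W.seqNorm d p β s u := by
  have hfin : ∀ (e : ℝ) (i : W.ι), W.scale i ^ e ≠ ∞ := fun e i =>
    ENNReal.rpow_ne_top_of_ne_zero (W.scale_ne_zero hΩ hne i) (W.scale_ne_top i)
  rw [lintegral_levelSum hp₀ hp₁ hη0 hη1 h0 h1 hp (hfin _) (hfin _)
    (W.coeff_ne_top hΩ hne hε hu), seqNorm]
  congr 1
  refine tsum_congr fun i => ?_
  rw [← ENNReal.rpow_mul, ← ENNReal.rpow_mul,
    ← ENNReal.rpow_add _ _ (W.scale_ne_zero hΩ hne i) (W.scale_ne_top i)]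
  congr 4
  rw [hs]; ring

end WhitneyPartition

variable {p₀ p₁ p s₀ s₁ s γ d c : ℝ} {β : ℝ≥0∞}

lemma kFunctional_le {X : Type*} [Add X] {A₀ A₁ : Set X} {N₀ N₁ : X → ℝ≥0∞} {t : ℝ} {a a₀ a₁ : X}
    (h₀ : a₀ ∈ A₀) (h₁ : a₁ ∈ A₁) (h : a₀ + a₁ = a) :
    kFunctional A₀ A₁ N₀ N₁ t a ≤ N₀ a₀ + ENNReal.ofReal t * N₁ a₁ :=
  iInf₂_le_of_le a₀ h₀ (iInf₂_le_of_le a₁ h₁ (iInf_le_of_le h le_rfl))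

/-- The parameter is `η = γ p / p₁`; the relation for `1 / p` says precisely that `1 - η = (1 - γ) p
/ p₀`. -/
lemma exists_interpolation_parameter (hp₀ : 0 < p₀) (hp₁ : 0 < p₁) (hγ : γ ∈ Ioo (0 : ℝ) 1)
    (hp : 1 / p = (1 - γ) / p₀ + γ / p₁) :
    0 < p ∧ ∃ η : ℝ, 0 < η ∧ η < 1 ∧ p₀ * (1 - η) = (1 - γ) * p ∧ p₁ * η = γ * p ∧
      p = (1 - η) * p₀ + η * p₁ := by
  obtain ⟨hγ0, hγ1⟩ := hγ
  have h1γ : 0 < 1 - γ := by linarith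
  have hp0 : 0 < p := by
    rw [← one_div_pos, hp]; positivity
  have e : 1 - γ * p / p₁ = (1 - γ) * p / p₀ := by
    have : p * (1 / p) = p * ((1 - γ) / p₀ + γ / p₁) := by rw [hp]
    rw [mul_one_div_cancel hp0.ne'] at this
    field_simp at this ⊢
    linarith
  have e0 : p₀ * (1 - γ * p / p₁) = (1 - γ) * p := by rw [e]; field_simp
  have e1 : p₁ * (γ * p / p₁) = γ * p := by field_simp
  refine ⟨hp0, γ * p / p₁, by positivity, ?_, e0, e1, by linarith⟩
  have : 0 < (1 - γ) * p / p₀ := by positivity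
  linarith

theorem exists_interpNorm_le (hΩ : IsOpen Ω) (hne : (frontier Ω).Nonempty) (hc : c ∈ Ioo (0 : ℝ) 1)
    (hβ : 1 ≤ β) (hp₀ : 0 < p₀) (hp₁ : 0 < p₁) (hγ : γ ∈ Ioo (0 : ℝ) 1)
    (hp : 1 / p = (1 - γ) / p₀ + γ / p₁) (hs : s = (1 - γ) * s₀ + γ * s₁) :
    ∃ C : ℝ≥0∞, C ≠ ∞ ∧ ∀ f ∈ avSpace Ω d p c β s V,
      f ∈ sumSpace (avSpace Ω d p₀ c β s₀ V) (avSpace Ω d p₁ c β s₁ V) ∧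
      interpNorm (avSpace Ω d p₀ c β s₀ V) (avSpace Ω d p₁ c β s₁ V)
        (avNorm Ω d p₀ c β s₀) (avNorm Ω d p₁ c β s₁) γ p f ≤ C * avNorm Ω d p c β s f := by
  obtain ⟨hc0, hc1⟩ := hc
  obtain ⟨hp', η, hη0, hη1, h0, h1, hpη⟩ := exists_interpolation_parameter hp₀ hp₁ hγ hp
  obtain ⟨W⟩ := exists_whitneyPartition hΩ hne (ε := c / 8) (by positivity) (by linarith)
  have hε0 : 0 < c / 8 := by positivity
  obtain ⟨C₀, hC₀, hU₀⟩ := W.exists_avNorm_le (V := V) hΩ hne hc0 hc1 hε0 le_rfl hβ hp₀ d s₀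
  obtain ⟨C₁, hC₁, hU₁⟩ := W.exists_avNorm_le (V := V) hΩ hne hc0 hc1 hε0 le_rfl hβ hp₁ d s₁
  obtain ⟨C₂, hC₂, hL⟩ := W.exists_seqNorm_le (V := V) hΩ hne hc0 hc1 hε0 le_rfl β hp' d s
  -- One constant dominating both comparisons; the 1 keeps it nonzero, so that it can be divided by.
  set C := C₀ + C₁ + 1 with hCdef
  have hC : C ≠ ∞ := by finiteness
  have hC0 : C ≠ 0 := by simp [hCdef]
  set D : ℝ≥0∞ := (2 * C) ^ p * ENNReal.ofReal p * ENNReal.ofReal (p₀⁻¹ * p₁⁻¹) *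
    ENNReal.ofReal (η⁻¹ + (1 - η)⁻¹) with hD
  have hDt : D ≠ ∞ := by
    have : (2 * C) ^ p ≠ ∞ := ENNReal.rpow_ne_top_of_nonneg hp'.le (by finiteness)
    finiteness
  refine ⟨D ^ (1 / p) * C₂, ENNReal.mul_ne_top
    (ENNReal.rpow_ne_top_of_nonneg (by positivity) hDt) hC₂, fun f hf => ?_⟩
  have hint := W.lintegral_levelSum_coeff (d := d) hΩ hne (by linarith) hp₀ hp₁ hp' hη0 hη1 h0 h1 hs
    hf.1
  have hmem₀ : ∀ I : Set W.ι, W.seqNorm d p₀ β s₀ (W.cut f I) ≠ ∞ →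
      W.cut f I ∈ avSpace Ω d p₀ c β s₀ V := fun I hI => ⟨W.memLpLoc_cut hf.1 I,
    (hU₀ _).trans_lt (ENNReal.mul_lt_top hC₀.lt_top
      (ENNReal.rpow_lt_top_of_nonneg (by positivity) hI))⟩
  have hmem₁ : ∀ I : Set W.ι, W.seqNorm d p₁ β s₁ (W.cut f I) ≠ ∞ →
      W.cut f I ∈ avSpace Ω d p₁ c β s₁ V := fun I hI => ⟨W.memLpLoc_cut hf.1 I,
    (hU₁ _).trans_lt (ENNReal.mul_lt_top hC₁.lt_top
      (ENNReal.rpow_lt_top_of_nonneg (by positivity) hI))⟩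
  constructor
  · have hfin : W.seqNorm d p β s f ≠ ∞ := ne_top_of_le_ne_top
      (ENNReal.rpow_ne_top_of_nonneg hp'.le (ENNReal.mul_ne_top hC₂ hf.2.ne)) (hL f)
    obtain ⟨I, hX, hY⟩ := exists_levelSet_ne_top
      (by rw [hint]; exact ENNReal.mul_ne_top ENNReal.ofReal_ne_top hfin)
    rw [← W.seqNorm_cut hp₀] at hX
    rw [← W.seqNorm_cut hp₁] at hY
    exact ⟨_, hmem₀ I hX, _, hmem₁ Iᶜ hY, W.cut_add_cut_compl hΩ f I⟩
  · have h := lintegral_le_of_split (u₀ := fun i => W.scale i ^ (1 - s₀))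
      (u₁ := fun i => W.scale i ^ (1 - s₁)) (m := fun i => W.scale i ^ d) (a := W.coeff β f)
      (k := fun t => kFunctional (avSpace Ω d p₀ c β s₀ V) (avSpace Ω d p₁ c β s₁ V)
        (avNorm Ω d p₀ c β s₀) (avNorm Ω d p₁ c β s₁) t f) hp₀ hp₁ hp'
      (by rw [mul_comm, h1]) hpη hC0 hC (by
        intro I t ht hX hY
        rw [← W.seqNorm_cut hp₀] at hX ⊢
        rw [← W.seqNorm_cut hp₁] at hY ⊢
        refine (kFunctional_le (hmem₀ I hX) (hmem₁ Iᶜ hY) (W.cut_add_cut_compl hΩ f I)).trans ?_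
        rw [mul_add, mul_left_comm C]
        gcongr
        · refine (hU₀ _).trans ?_
          gcongr
          rw [hCdef, add_assoc]; exact le_self_add
        · refine (hU₁ _).trans ?_
          gcongr
          rw [hCdef, add_comm C₀, add_assoc]; exact le_self_add)
    rw [hint, ← mul_assoc, ← hD] at h
    calc _ ≤ (D * W.seqNorm d p β s f) ^ (1 / p) := ENNReal.rpow_le_rpow h (by positivity)
      _ ≤ (D * (C₂ * avNorm Ω d p c β s f) ^ p) ^ (1 / p) := by gcongr; exact hL f
      _ = _ := by
        rw [ENNReal.mul_rpow_of_nonneg _ _ (by positivity), one_div, ENNReal.rpow_rpow_inv hp'.ne',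
          mul_assoc]

theorem exists_avNorm_le_interpNorm (hΩ : IsOpen Ω) (hne : (frontier Ω).Nonempty)
    (hc : c ∈ Ioo (0 : ℝ) 1) (hβ : 1 ≤ β) (hp₀ : 0 < p₀) (hp₁ : 0 < p₁) (hγ : γ ∈ Ioo (0 : ℝ) 1)
    (hp : 1 / p = (1 - γ) / p₀ + γ / p₁) (hs : s = (1 - γ) * s₀ + γ * s₁) :
    ∃ C : ℝ≥0∞, C ≠ ∞ ∧ ∀ f : EuclideanSpace ℝ (Fin n) →ₘ[volume.restrict Ω] V,
      MemLpLoc Ω β f → avNorm Ω d p c β s f ≤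
        C * interpNorm (avSpace Ω d p₀ c β s₀ V) (avSpace Ω d p₁ c β s₁ V)
          (avNorm Ω d p₀ c β s₀) (avNorm Ω d p₁ c β s₁) γ p f := by
  obtain ⟨hc0, hc1⟩ := hc
  obtain ⟨hp', η, hη0, hη1, h0, h1, hpη⟩ := exists_interpolation_parameter hp₀ hp₁ hγ hp
  obtain ⟨W⟩ := exists_whitneyPartition hΩ hne (ε := c / 8) (by positivity) (by linarith)
  have hε0 : 0 < c / 8 := by positivity
  obtain ⟨C₀, hC₀, hL₀⟩ := W.exists_seqNorm_le (V := V) hΩ hne hc0 hc1 hε0 le_rfl β hp₀ d s₀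
  obtain ⟨C₁, hC₁, hL₁⟩ := W.exists_seqNorm_le (V := V) hΩ hne hc0 hc1 hε0 le_rfl β hp₁ d s₁
  obtain ⟨C₂, hC₂, hU⟩ := W.exists_avNorm_le (V := V) hΩ hne hc0 hc1 hε0 le_rfl hβ hp' d s
  set C := C₀ + C₁ + 1 with hCdef
  have hC : C ≠ ∞ := by finiteness
  have hC0 : C ≠ 0 := by simp [hCdef]
  have h1η : 0 < 1 - η := by linarith
  set E := ENNReal.ofReal (η⁻¹ + (1 - η)⁻¹) with hE
  have hE0 : E ≠ 0 := by
    simpa [hE] using (show 0 < η⁻¹ + (1 - η)⁻¹ by positivity)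
  set D : ℝ≥0∞ := ((2 * C) ^ p₀ + (2 * C) ^ p₁) *
    (ENNReal.ofReal (p₀ * p₁) * (ENNReal.ofReal p⁻¹ * 2 ^ p)) with hD
  have hDt : D ≠ ∞ := by
    have e0 : (2 * C) ^ p₀ ≠ ∞ := ENNReal.rpow_ne_top_of_nonneg hp₀.le (by finiteness)
    have e1 : (2 * C) ^ p₁ ≠ ∞ := ENNReal.rpow_ne_top_of_nonneg hp₁.le (by finiteness)
    finiteness
  refine ⟨C₂ * (E⁻¹ * D) ^ (1 / p), ENNReal.mul_ne_top hC₂ (ENNReal.rpow_ne_top_of_nonneg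
    (by positivity) (ENNReal.mul_ne_top (ENNReal.inv_ne_top.2 hE0) hDt)), fun f hf => ?_⟩
  have hint := W.lintegral_levelSum_coeff (d := d) hΩ hne (by linarith) hp₀ hp₁ hp' hη0 hη1 h0 h1 hs
    hf
  have h := le_lintegral_of_split (u₀ := fun i => W.scale i ^ (1 - s₀))
    (u₁ := fun i => W.scale i ^ (1 - s₁)) (m := fun i => W.scale i ^ d) (a := W.coeff β f)
    (k := fun t => kFunctional (avSpace Ω d p₀ c β s₀ V) (avSpace Ω d p₁ c β s₁ V)
      (avNorm Ω d p₀ c β s₀) (avNorm Ω d p₁ c β s₁) t f) hp₀ hp₁ hp'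
    (by rw [mul_comm, h1]) hpη hC0 hC (by
      -- A value above the infimum is exceeded by no less than one actual decomposition `f₀ + f₁`;
      -- the coefficients of `f₀` and `f₁` give the required splitting of the sequence.
      intro t ht v hv
      simp only [kFunctional, iInf_lt_iff] at hv
      obtain ⟨f₀, hf₀, f₁, hf₁, hff, hlt⟩ := hv
      refine ⟨W.coeff β f₀, W.coeff β f₁, fun i => hff ▸ W.coeff_add_le hβ f₀ f₁ i, ?_, ?_⟩
      · refine (hL₀ f₀).trans ?_
        gcongr
        · rw [hCdef, add_assoc]; exact le_self_add
        · exact le_self_add.trans hlt.le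
      · refine (hL₁ f₁).trans ?_
        gcongr
        · rw [hCdef, add_comm C₀, add_assoc]; exact le_self_add
        · rw [ENNReal.le_div_iff_mul_le (Or.inl (by simpa using ht))
            (Or.inl ENNReal.ofReal_ne_top), mul_comm]
          exact le_add_self.trans hlt.le)
  rw [hint, ← hD, ← hE] at h
  have h' := mul_le_mul_right h E⁻¹
  rw [← mul_assoc, ENNReal.inv_mul_cancel hE0 ENNReal.ofReal_ne_top, one_mul, ← mul_assoc] at h'
  refine (hU f).trans ?_
  rw [mul_assoc, interpNorm, ← ENNReal.mul_rpow_of_nonneg _ _ (by positivity)]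
  gcongr

lemma memLpLoc_of_mem_sumSpace {f : EuclideanSpace ℝ (Fin n) →ₘ[volume.restrict Ω] V}
    (hf : f ∈ sumSpace (avSpace Ω d p₀ c β s₀ V) (avSpace Ω d p₁ c β s₁ V)) :
    MemLpLoc Ω β f := by
  obtain ⟨f₀, h₀, f₁, h₁, rfl⟩ := hf
  intro K hK hKΩ
  exact ((h₀.1 K hK hKΩ).add (h₁.1 K hK hKΩ)).ae_eq
    (Filter.EventuallyEq.symm (ae_mono (Measure.restrict_mono hKΩ le_rfl) (AEEqFun.coeFn_add f₀ f₁)))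

end Interpolation

end WhitneyAv

end

theorem mainTheorem4 {n : ℕ} {d : ℝ} (hd0 : 0 < d) (hdn : d < n)
    {V : Type*} [NormedAddCommGroup V] [NormedSpace ℝ V] [FiniteDimensional ℝ V]
    (Ω : Set (EuclideanSpace ℝ (Fin n))) (hΩ : IsOpen Ω)
    (hreg : WhitneyAv.AhlforsRegular d (frontier Ω))
    (p₀ p₁ : ℝ) (hp₀ : 0 < p₀) (hp₁ : 0 < p₁)
    (β : ℝ≥0∞) (hβ : 1 ≤ β) (s₀ s₁ : ℝ)
    (c : ℝ) (hc : c ∈ Ioo (0 : ℝ) 1) (γ : ℝ) (hγ : γ ∈ Ioo (0 : ℝ) 1)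
    (pγ sγ : ℝ) (hpγ : 1 / pγ = (1 - γ) / p₀ + γ / p₁) (hsγ : sγ = (1 - γ) * s₀ + γ * s₁) :
    WhitneyAv.interpSpace
        (WhitneyAv.avSpace Ω d p₀ c β s₀ V) (WhitneyAv.avSpace Ω d p₁ c β s₁ V)
        (WhitneyAv.avNorm Ω d p₀ c β s₀) (WhitneyAv.avNorm Ω d p₁ c β s₁) γ pγ
      = WhitneyAv.avSpace Ω d pγ c β sγ V ∧
    ∃ C : ℝ≥0, 0 < C ∧ ∀ f ∈ WhitneyAv.avSpace Ω d pγ c β sγ V,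
      WhitneyAv.interpNorm
          (WhitneyAv.avSpace Ω d p₀ c β s₀ V) (WhitneyAv.avSpace Ω d p₁ c β s₁ V)
          (WhitneyAv.avNorm Ω d p₀ c β s₀) (WhitneyAv.avNorm Ω d p₁ c β s₁) γ pγ f
        ≤ C * WhitneyAv.avNorm Ω d pγ c β sγ f ∧
      WhitneyAv.avNorm Ω d pγ c β sγ f
        ≤ C * WhitneyAv.interpNorm
          (WhitneyAv.avSpace Ω d p₀ c β s₀ V) (WhitneyAv.avSpace Ω d p₁ c β s₁ V)
          (WhitneyAv.avNorm Ω d p₀ c β s₀) (WhitneyAv.avNorm Ω d p₁ c β s₁) γ pγ f := by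
  obtain ⟨C₁, hC₁, h₁⟩ := WhitneyAv.exists_interpNorm_le (V := V) (d := d) hΩ hreg.1 hc hβ hp₀ hp₁
    hγ hpγ hsγ
  obtain ⟨C₂, hC₂, h₂⟩ := WhitneyAv.exists_avNorm_le_interpNorm (V := V) (d := d) hΩ hreg.1 hc hβ
    hp₀ hp₁ hγ hpγ hsγ
  refine ⟨Set.ext fun f => ⟨fun hf => ?_, fun hf => ?_⟩, ?_⟩
  · have hloc := WhitneyAv.memLpLoc_of_mem_sumSpace hf.1
    exact ⟨hloc, (h₂ f hloc).trans_lt (ENNReal.mul_lt_top hC₂.lt_top hf.2)⟩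
  · exact ⟨(h₁ f hf).1, (h₁ f hf).2.trans_lt (ENNReal.mul_lt_top hC₁.lt_top hf.2)⟩
  · lift C₁ to ℝ≥0 using hC₁
    lift C₂ to ℝ≥0 using hC₂
    refine ⟨C₁ + C₂ + 1, by positivity, fun f hf => ⟨(h₁ f hf).2.trans ?_, (h₂ f hf.1).trans ?_⟩⟩
    · gcongr
      rw [add_assoc]; exact le_self_add
    · gcongr
      rw [add_comm C₁, add_assoc]; exact le_self_add
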